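/- Let $q\ge 1$ and $k\ge1$ be integers, and let $\sigma\ge1$ and $X\ge1$ be real numbers. Let $\mu$ denote the Möbius function and $\varphi$ Euler's totient function. Then $$0\le \sum_{\substack{n\le X\\ (n,q)=1}}\frac{\mu(n)}{n^{\sigma}}\log^k\Bigl(\frac{X}{n}\Bigr)\le 1.00303\,\frac{q}{\varphi(q)}\bigl(k+(\sigma-1)\log X\bigr)(\log X)^{k-1},$$ where the sum runs over the positive integers $n\le X$ coprime to $q$ (and $(\log X)^{0}=1$, also for $X=1$). When $k\neq1$, the constant $1.00303$ may be replaced by $1$. -/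

import Mathlib

section

open ArithmeticFunction.zeta ArithmeticFunction.Moebius

/-! Write M_k(X) for the sum of μ(n)/n · log^k(X/n) over n ≤ X, the case q = σ = 1. The general sum
reduces to M_1 and M_2.

Exponent: with ε = σ - 1, n^(-σ) equals X^(-ε) · n^(-1) · e^(ε log(X/n)). Expanding the exponential
gives nonnegative combinations of the sums with power k + j, and the bounds add up in closed form
(`wsum_log_pow_exp_bounds`). Coprimality: excluding one more prime p turns S into S' with S'(X) =
S(X) + S'(X/p)/p, so bounds survive with a factor (1 - 1/p)⁻¹
(`wsum_moebiusAvoiding_insert_bounds`); the product of these factors is q/φ(q). Powers: the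
derivative of M_(k+1) in log X is (k+1) M_k, so 0 ≤ M_k and M_k ≤ k log^(k-1) X integrate up from
M_1 and M_2 respectively.

For M_2, the sum of log(u/n)/n over n ≤ u is log² u / 2 + γ log u + d + O(1/u²). Möbius inversion
expresses log X as M_2/2 + γ M_1 + d·(sum of μ(n)/n) + a small error, and M_1 ≥ 0.85 makes the last
three terms nonnegative in total when X ≥ 3.

For M_1, integers up to 8192 are checked by interval arithmetic. Beyond that, take c supported on
[1, 23] with sum of c(n)/n equal to 0. Then the mean of c * ζ with weight log is κ log y + F(y),
where F is close to a constant, and μ * (c * ζ) = c gives κ(1 - M_1(N)) as the sum of μ(n)/n ·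
F(N/n) (`slope_mul_moebius_error`). Small quotients N/n are handled by computed values of F, large
ones by |sum of μ(n)/n| ≤ 1. Since M_1 is affine in log X between integers, integer values suffice.
-/

/-! ### Weighted Dirichlet convolutions and logarithmic means between integers. -/

theorem sum_Ioc_mul_weight (f g : ArithmeticFunction ℝ) (F : ℕ → ℝ) (N : ℕ) :
    ∑ n ∈ Finset.Ioc 0 N, (f * g) n * F n =
      ∑ d ∈ Finset.Ioc 0 N, f d * ∑ m ∈ Finset.Ioc 0 (N / d), g m * F (d * m) := by
  have h1 : ∑ n ∈ Finset.Ioc 0 N, (f * g) n * F n =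
      ∑ x ∈ Finset.Ioc 0 N ×ˢ Finset.Ioc 0 N with x.1 * x.2 ≤ N,
        f x.1 * g x.2 * F (x.1 * x.2) := by
    trans ∑ n ∈ Finset.Ioc 0 N, ∑ x ∈ Finset.Ioc 0 N ×ˢ Finset.Ioc 0 N with x.1 * x.2 = n,
      f x.1 * g x.2 * F (x.1 * x.2)
    · refine Finset.sum_congr rfl fun n hn => ?_
      simp only [Finset.mem_Ioc] at hn
      have hn0 : n ≠ 0 := by lia
      rw [ArithmeticFunction.mul_apply,
        Nat.divisorsAntidiagonal_eq_prod_filter_of_le hn0 hn.2, Finset.sum_mul]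
      refine Finset.sum_congr rfl fun x hx => ?_
      rw [(Finset.mem_filter.1 hx).2]
    · simp_rw [Finset.sum_filter]
      rw [Finset.sum_comm]
      refine Finset.sum_congr rfl fun x hx => ?_
      simp only [Finset.mem_product, Finset.mem_Ioc] at hx
      have : 0 < x.1 * x.2 := Nat.mul_pos hx.1.1 hx.2.1
      simp [this]
  rw [h1, Finset.sum_filter, Finset.sum_product]
  refine Finset.sum_congr rfl fun d hd => ?_
  rw [Finset.mem_Ioc] at hd
  rw [← Finset.sum_filter, Finset.mul_sum]
  have : {m ∈ Finset.Ioc 0 N | d * m ≤ N} = Finset.Ioc 0 (N / d) := by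
    ext m
    simp only [Finset.mem_filter, Finset.mem_Ioc, Nat.le_div_iff_mul_le hd.1, mul_comm m d]
    constructor
    · rintro ⟨⟨a, b⟩, c⟩; exact ⟨a, c⟩
    · rintro ⟨a, c⟩
      exact ⟨⟨a, (Nat.le_mul_of_pos_left m hd.1).trans c⟩, c⟩
  rw [this]
  exact Finset.sum_congr rfl fun m _ => by ring

/-- The weighted mean `∑_{n ≤ y} f n / n * w (y / n)`. -/
noncomputable def wsum (f : ArithmeticFunction ℝ) (w : ℝ → ℝ) (y : ℝ) : ℝ :=
  ∑ n ∈ Finset.Ioc 0 ⌊y⌋₊, f n / n * w (y / n)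

theorem wsum_mul (f g : ArithmeticFunction ℝ) (w : ℝ → ℝ) (y : ℝ) :
    wsum (f * g) w y = ∑ d ∈ Finset.Ioc 0 ⌊y⌋₊, f d / d * wsum g w (y / d) := by
  unfold wsum
  have := sum_Ioc_mul_weight f g (fun n => 1 / n * w (y / n)) ⌊y⌋₊
  calc _ = ∑ n ∈ Finset.Ioc 0 ⌊y⌋₊, (f * g) n * (1 / n * w (y / n)) :=
        Finset.sum_congr rfl fun n _ => by ring
    _ = _ := by
        rw [this]
        refine Finset.sum_congr rfl fun d _ => ?_
        rw [Nat.floor_div_natCast, Finset.mul_sum, Finset.mul_sum]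
        refine Finset.sum_congr rfl fun m _ => ?_
        push_cast
        rw [div_div]
        ring

theorem wsum_one (w : ℝ → ℝ) {y : ℝ} (hy : 1 ≤ y) : wsum 1 w y = w y := by
  unfold wsum
  rw [Finset.sum_eq_single_of_mem 1 (by simpa using hy)]
  · simp
  · intro b _ hb
    simp [hb]

theorem wsum_eq_zero (f : ArithmeticFunction ℝ) (w : ℝ → ℝ) {y : ℝ} (hy : y < 1) :
    wsum f w y = 0 := by
  simp [wsum, Nat.floor_eq_zero.2 hy]

/-- The mean `∑_{n ≤ N} f n / n`. -/
noncomputable def harmSum (f : ArithmeticFunction ℝ) (N : ℕ) : ℝ :=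
  ∑ n ∈ Finset.Ioc 0 N, f n / n

theorem harmSum_succ (f : ArithmeticFunction ℝ) (N : ℕ) :
    harmSum f (N + 1) = harmSum f N + f (N + 1) / ((N : ℝ) + 1) := by
  simp [harmSum, Finset.sum_Ioc_succ_top]

theorem wsum_log_eq (f : ArithmeticFunction ℝ) {N : ℕ} (hN : 1 ≤ N) {y : ℝ} (h1 : (N : ℝ) ≤ y)
    (h2 : y ≤ N + 1) :
    wsum f Real.log y = wsum f Real.log N + harmSum f N * Real.log (y / N) := by
  have hN0 : (0 : ℝ) < N := by exact_mod_cast hN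
  have key : ∑ n ∈ Finset.Ioc 0 N, f n / n * Real.log (y / n) =
      wsum f Real.log N + harmSum f N * Real.log (y / N) := by
    simp only [wsum, harmSum, Nat.floor_natCast, Finset.sum_mul, ← Finset.sum_add_distrib]
    refine Finset.sum_congr rfl fun n hn => ?_
    rw [Finset.mem_Ioc] at hn
    have hn0 : (0 : ℝ) < n := by exact_mod_cast hn.1
    rw [Real.log_div (by linarith) hn0.ne', Real.log_div hN0.ne' hn0.ne',
      Real.log_div (by linarith) hN0.ne']
    ring
  -- At y = N + 1 the floor jumps, but the new term carries log 1 = 0, so the formula holds on the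
  -- closed interval.
  rcases h2.eq_or_lt with h | h
  · have hf : ⌊y⌋₊ = N + 1 := by rw [h]; exact_mod_cast Nat.floor_natCast (N + 1)
    rw [← key, wsum, hf, Finset.sum_Ioc_succ_top (by lia), h]
    push_cast
    rw [div_self (by positivity : (N : ℝ) + 1 ≠ 0)]
    simp
  · have hf : ⌊y⌋₊ = N := (Nat.floor_eq_iff (by linarith)).2 ⟨h1, h⟩
    rw [← key, wsum, hf]

theorem wsum_log_succ (f : ArithmeticFunction ℝ) {N : ℕ} (hN : 1 ≤ N) :
    wsum f Real.log (N + 1 : ℕ) =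
      wsum f Real.log N + harmSum f N * Real.log ((N + 1 : ℝ) / N) := by
  have := wsum_log_eq f hN (y := (N : ℝ) + 1) (by linarith) le_rfl
  exact_mod_cast this

theorem wsum_log_one (f : ArithmeticFunction ℝ) : wsum f Real.log (1 : ℕ) = 0 := by
  simp [wsum]

/-- An affine function of log y attains its minimum over [N, N + 1] at an endpoint; this passes
bounds from integers to reals. -/
theorem le_of_linear_log {N y p q B : ℝ} (hN : 0 < N) (h1 : N ≤ y) (h2 : y ≤ N + 1)
    (hp : B ≤ p) (hq : B ≤ p + q * Real.log ((N + 1) / N)) : B ≤ p + q * Real.log (y / N) := by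
  have hl0 : 0 ≤ Real.log (y / N) := Real.log_nonneg (by rwa [le_div_iff₀ hN, one_mul])
  have hl1 : Real.log (y / N) ≤ Real.log ((N + 1) / N) :=
    Real.log_le_log (div_pos (by linarith) hN) (by gcongr)
  rcases le_total 0 q with h | h
  · nlinarith
  · nlinarith

theorem linear_log_le {N y p q B : ℝ} (hN : 0 < N) (h1 : N ≤ y) (h2 : y ≤ N + 1)
    (hp : p ≤ B) (hq : p + q * Real.log ((N + 1) / N) ≤ B) : p + q * Real.log (y / N) ≤ B := by
  have := le_of_linear_log (p := -p) (q := -q) (B := -B) hN h1 h2 (by linarith) (by linarith)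
  linarith

theorem floor_bounds {y : ℝ} (hy : 1 ≤ y) :
    1 ≤ ⌊y⌋₊ ∧ (⌊y⌋₊ : ℝ) ≤ y ∧ y ≤ ⌊y⌋₊ + 1 :=
  ⟨(Nat.one_le_floor_iff y).2 hy, Nat.floor_le (by linarith), (Nat.lt_floor_add_one y).le⟩

/-! ### Asymptotics of the sum of log(u/n)/n, with explicit error. -/

theorem log_sub_log_le_of_lt_one {x : ℝ} (h0 : 0 ≤ x) (h1 : x < 1) :
    Real.log (1 + x) - Real.log (1 - x) ≤ 2 * x + 2 / 3 * x ^ 3 / (1 - x ^ 2) := by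
  have hs := Real.hasSum_log_sub_log_of_abs_lt_one (abs_lt.2 ⟨by linarith, h1⟩)
  have hx2 : x ^ 2 < 1 := by nlinarith
  -- The geometric majorant replaces 1/(2k+1) by 1/3, which is too small at k = 0; the extra 4/3 · x
  -- repairs that term.
  have hg := ((hasSum_geometric_of_lt_one (sq_nonneg x) hx2).mul_left (2 / 3 * x)).add
    (hasSum_ite_eq (0 : ℕ) (4 / 3 * x))
  refine (hasSum_le (fun k => ?_) hs hg).trans (le_of_eq ?_)
  · rcases k.eq_zero_or_pos with rfl | hk
    · simp; linarith
    · have hk1 : (1 : ℝ) ≤ k := by exact_mod_cast hk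
      have hle : 1 / (2 * (k : ℝ) + 1) ≤ 1 / 3 :=
        one_div_le_one_div_of_le (by norm_num) (by linarith)
      have hp : 0 ≤ x ^ (2 * k + 1) := by positivity
      rw [if_neg hk.ne', add_zero, ← pow_mul,
        show 2 / 3 * x * x ^ (2 * k) = 2 * (1 / 3) * x ^ (2 * k + 1) by ring]
      gcongr
  · have : (1 : ℝ) - x ^ 2 ≠ 0 := by linarith
    field_simp
    ring

/-- This is t ≤ sinh t at t = log((N+1)/N). -/
theorem log_add_one_div_le {N : ℝ} (hN : 0 < N) :
    Real.log ((N + 1) / N) ≤ (2 * N + 1) / (2 * N * (N + 1)) := by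
  have hpos : 0 < (N + 1) / N := by positivity
  have h1 : 0 ≤ Real.log ((N + 1) / N) :=
    Real.log_nonneg (by rw [le_div_iff₀ hN]; linarith)
  have h2 := Real.self_le_sinh_iff.2 h1
  rw [Real.sinh_log hpos] at h2
  refine h2.trans (le_of_eq ?_)
  field_simp
  ring

theorem harmSum_zeta (N : ℕ) : harmSum (ζ : ArithmeticFunction ℝ) N = harmonic N := by
  rw [harmonic_eq_sum_Icc, harmSum]
  push_cast
  refine Finset.sum_congr (by ext; simp [Nat.lt_iff_add_one_le]) fun n hn => ?_
  have : n ≠ 0 := by have := (Finset.mem_Icc.1 hn).1; lia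
  simp [ArithmeticFunction.natCoe_apply, ArithmeticFunction.zeta_apply, this]

/-- The harmonic numbers centred by the logarithms at both ends of `[N, N + 1]`. -/
noncomputable def centredHarmonic (N : ℕ) : ℝ :=
  harmSum (ζ : ArithmeticFunction ℝ) N - (Real.log N + Real.log (N + 1)) / 2

theorem tendsto_centredHarmonic :
    Filter.Tendsto centredHarmonic Filter.atTop (nhds Real.eulerMascheroniConstant) := by
  have h := (Real.tendsto_harmonic_sub_log.add Real.tendsto_harmonic_sub_log_add_one).div_const 2
  rw [add_self_div_two] at h
  refine h.congr fun N => ?_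
  rw [centredHarmonic, harmSum_zeta]
  ring

theorem centredHarmonic_sub_succ {N : ℕ} (hN : 1 ≤ N) :
    0 ≤ centredHarmonic N - centredHarmonic (N + 1) ∧
    centredHarmonic N - centredHarmonic (N + 1) ≤
      1 / (6 * N * (N + 1)) - 1 / (6 * ((N : ℝ) + 1) * (N + 2)) := by
  have hN0 : (0 : ℝ) < N := by exact_mod_cast hN
  set x : ℝ := 1 / (N + 1) with hx
  have hx0 : 0 ≤ x := by positivity
  have hx1 : x < 1 := by rw [hx, div_lt_one (by positivity)]; linarith
  have h1x : 1 + x = (N + 2) / (N + 1) := by rw [hx]; field_simp; ring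
  have h2x : 1 - x = N / (N + 1) := by rw [hx]; field_simp; ring
  have hlog : Real.log (1 + x) - Real.log (1 - x) = Real.log (N + 2) - Real.log N := by
    rw [h1x, h2x, Real.log_div (by positivity) (by positivity),
      Real.log_div (by positivity) (by positivity)]
    ring
  have hdiff : centredHarmonic N - centredHarmonic (N + 1) =
      (Real.log (1 + x) - Real.log (1 - x)) / 2 - x := by
    rw [hlog, centredHarmonic, centredHarmonic, harmSum_succ, hx]
    have : ((ζ : ArithmeticFunction ℝ) (N + 1)) = 1 := by
      simp [ArithmeticFunction.natCoe_apply, ArithmeticFunction.zeta_apply]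
    rw [this]
    push_cast
    ring_nf
  rw [hdiff]
  constructor
  · have := Real.sum_range_le_log_div hx0 hx1 1
    rw [Real.log_div (by linarith) (by linarith)] at this
    simp at this
    linarith
  · have := log_sub_log_le_of_lt_one hx0 hx1
    have e : 2 / 3 * x ^ 3 / (1 - x ^ 2) =
        2 * (1 / (6 * N * (N + 1)) - 1 / (6 * ((N : ℝ) + 1) * (N + 2))) := by
      have : 1 - x ^ 2 = N * (N + 2) / (N + 1) ^ 2 := by rw [hx]; field_simp; ring
      rw [this, hx]
      field_simp
      ring
    linarith

/-- Both sequences, centred and centred minus 1/(6N(N+1)), are monotone by the increment bounds and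
tend to γ. -/
theorem centredHarmonic_bounds {N : ℕ} (hN : 1 ≤ N) :
    Real.eulerMascheroniConstant ≤ centredHarmonic N ∧
    centredHarmonic N - Real.eulerMascheroniConstant ≤ 1 / (6 * N * (N + 1)) := by
  obtain ⟨M, rfl⟩ := Nat.exists_eq_add_of_le' hN
  have ht := (Filter.tendsto_add_atTop_iff_nat 1).2 tendsto_centredHarmonic
  constructor
  · refine (antitone_nat_of_succ_le (f := fun n => centredHarmonic (n + 1))
      fun n => ?_).le_of_tendsto ht M
    linarith [(centredHarmonic_sub_succ (N := n + 1) (by lia)).1]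
  · have h0 : Filter.Tendsto (fun n : ℕ => 1 / (6 * ((n + 1 : ℕ) : ℝ) * ((n + 1 : ℕ) + 1)))
        Filter.atTop (nhds 0) := by
      refine squeeze_zero (fun n => by positivity) (fun n => ?_)
        tendsto_one_div_add_atTop_nhds_zero_nat
      refine one_div_le_one_div_of_le (by positivity) ?_
      push_cast
      nlinarith [(Nat.cast_nonneg n : (0 : ℝ) ≤ n)]
    have ht2 := ht.sub h0
    rw [sub_zero] at ht2
    have := (monotone_nat_of_le_succ (f := fun n : ℕ => centredHarmonic (n + 1) -
      1 / (6 * ((n + 1 : ℕ) : ℝ) * ((n + 1 : ℕ) + 1))) fun n => ?_).ge_of_tendsto ht2 M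
    · linarith
    · have := (centredHarmonic_sub_succ (N := n + 1) (by lia)).2
      push_cast at this ⊢
      rw [show (n : ℝ) + 1 + 1 + 1 = n + 1 + 2 by ring]
      linarith

/-- The error of the quadratic approximation to `∑_{n ≤ N} log (N / n) / n`. -/
noncomputable def logHarmonicError (N : ℕ) : ℝ :=
  wsum (ζ : ArithmeticFunction ℝ) Real.log N - Real.log N ^ 2 / 2 -
    Real.eulerMascheroniConstant * Real.log N

/-- Centring at both ends is what makes this exact: the increment of log²/2 is the log ratio times
the average of the two logarithms. -/
theorem logHarmonicError_succ {N : ℕ} (hN : 1 ≤ N) :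
    logHarmonicError (N + 1) = logHarmonicError N +
      Real.log ((N + 1) / N) * (centredHarmonic N - Real.eulerMascheroniConstant) := by
  have hN0 : (0 : ℝ) < N := by exact_mod_cast hN
  rw [logHarmonicError, wsum_log_succ _ hN, logHarmonicError, centredHarmonic,
    Real.log_div (by positivity) (by positivity)]
  push_cast
  ring

theorem logHarmonicError_succ_bounds {N : ℕ} (hN : 1 ≤ N) :
    logHarmonicError N ≤ logHarmonicError (N + 1) ∧
    logHarmonicError (N + 1) ≤ logHarmonicError N +
      (1 / (12 * (N : ℝ) ^ 2) - 1 / (12 * ((N : ℝ) + 1) ^ 2)) := by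
  have hN0 : (0 : ℝ) < N := by exact_mod_cast hN
  have h1 : 0 ≤ Real.log (((N : ℝ) + 1) / N) :=
    Real.log_nonneg (by rw [le_div_iff₀ hN0]; linarith)
  have h2 := log_add_one_div_le hN0
  obtain ⟨h3, h4⟩ := centredHarmonic_bounds hN
  rw [logHarmonicError_succ hN]
  constructor
  · nlinarith
  · have := mul_le_mul h2 h4 (by linarith) (by positivity)
    -- The product of the two upper bounds telescopes exactly.
    have e : (2 * (N : ℝ) + 1) / (2 * N * (N + 1)) * (1 / (6 * N * (N + 1))) =
        1 / (12 * (N : ℝ) ^ 2) - 1 / (12 * ((N : ℝ) + 1) ^ 2) := by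
      field_simp
      ring
    linarith

/-- The error increases while the error plus 1/(12N²) decreases, so the supremum of the former
separates them. -/
theorem exists_logHarmonicError_bounds : ∃ d : ℝ, ∀ N : ℕ, 1 ≤ N →
    logHarmonicError N ≤ d ∧ d ≤ logHarmonicError N + 1 / (12 * (N : ℝ) ^ 2) := by
  have hmono : Monotone fun n : ℕ => logHarmonicError (n + 1) :=
    monotone_nat_of_le_succ fun n => (logHarmonicError_succ_bounds (by lia)).1
  have hanti : Antitone fun n : ℕ =>
      logHarmonicError (n + 1) + 1 / (12 * ((n + 1 : ℕ) : ℝ) ^ 2) :=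
    antitone_nat_of_succ_le fun n => by
      have := (logHarmonicError_succ_bounds (N := n + 1) (by lia)).2
      push_cast at this ⊢
      linarith
  have hub : ∀ m n : ℕ, logHarmonicError (m + 1) ≤
      logHarmonicError (n + 1) + 1 / (12 * ((n + 1 : ℕ) : ℝ) ^ 2) := fun m n => by
    have h1 := hmono (le_max_left m n)
    have h2 := hanti (le_max_right m n)
    have h3 : 0 ≤ 1 / (12 * ((max m n + 1 : ℕ) : ℝ) ^ 2) := by positivity
    simp only at h1 h2
    linarith
  refine ⟨⨆ n : ℕ, logHarmonicError (n + 1), fun N hN => ?_⟩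
  obtain ⟨M, rfl⟩ := Nat.exists_eq_add_of_le' hN
  exact ⟨le_ciSup (f := fun n : ℕ => logHarmonicError (n + 1))
    ⟨_, by rintro _ ⟨m, rfl⟩; exact hub m 0⟩ M, ciSup_le fun m => hub m M⟩

theorem exists_wsum_zeta_log_bound : ∃ d : ℝ, 0 ≤ d ∧ d ≤ 1 / 12 ∧ ∀ u : ℝ, 1 ≤ u →
    |wsum (ζ : ArithmeticFunction ℝ) Real.log u -
      (Real.log u ^ 2 / 2 + Real.eulerMascheroniConstant * Real.log u + d)| ≤
      1 / (8 * (⌊u⌋₊ : ℝ) ^ 2) := by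
  obtain ⟨d, hd⟩ := exists_logHarmonicError_bounds
  have h1 := hd 1 le_rfl
  have hE : logHarmonicError 1 = 0 := by
    rw [logHarmonicError, wsum_log_one]
    simp
  rw [hE] at h1
  refine ⟨d, h1.1, by norm_num at h1; linarith, fun u hu => ?_⟩
  obtain ⟨hN, hNu, huN⟩ := floor_bounds hu
  set N := ⌊u⌋₊
  have hN0 : (0 : ℝ) < N := by exact_mod_cast hN
  obtain ⟨h2, h3⟩ := hd N hN
  have h4 := (hd (N + 1) (by lia)).1
  rw [logHarmonicError_succ hN] at h4
  obtain ⟨h5, -⟩ := centredHarmonic_bounds hN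
  set w := Real.log (((N : ℝ) + 1) / N) with hw
  set v := Real.log (u / N) with hv
  have hv0 : 0 ≤ v := Real.log_nonneg (by rwa [le_div_iff₀ hN0, one_mul])
  have hvw : v ≤ w := Real.log_le_log (div_pos (by linarith) hN0) (by gcongr)
  have hw1 : w ≤ 1 / N := by
    have := Real.log_le_sub_one_of_pos (x := ((N : ℝ) + 1) / N) (by positivity)
    rw [show ((N : ℝ) + 1) / N - 1 = 1 / N by field_simp; ring] at this
    exact this
  have hlu : Real.log u = Real.log N + v := by
    rw [hv, Real.log_div (by linarith) hN0.ne']; ring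
  have hw2 : w = Real.log (N + 1) - Real.log N := by
    rw [hw, Real.log_div (by positivity) hN0.ne']
  have key : wsum (ζ : ArithmeticFunction ℝ) Real.log u -
      (Real.log u ^ 2 / 2 + Real.eulerMascheroniConstant * Real.log u + d) =
      (logHarmonicError N - d) + v * (centredHarmonic N - Real.eulerMascheroniConstant) +
        v * (w - v) / 2 := by
    rw [wsum_log_eq _ hN hNu huN, hlu, logHarmonicError, centredHarmonic, hw2]
    ring
  have hsq : w ^ 2 ≤ 1 / (N : ℝ) ^ 2 := by
    rw [← one_div_pow]; exact pow_le_pow_left₀ (hv0.trans hvw) hw1 2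
  have e8 : 1 / (8 * (N : ℝ) ^ 2) = 1 / (N : ℝ) ^ 2 / 8 := by field_simp
  have e12 : 1 / (12 * (N : ℝ) ^ 2) = 1 / (N : ℝ) ^ 2 / 12 := by field_simp
  have hpos : 0 ≤ 1 / (N : ℝ) ^ 2 := by positivity
  have a1 := mul_nonneg hv0 (sub_nonneg.2 h5)
  have a2 := mul_nonneg hv0 (sub_nonneg.2 hvw)
  have a3 := mul_le_mul_of_nonneg_right hvw (sub_nonneg.2 h5)
  rw [key, abs_le, e8]
  constructor
  · linarith
  -- The first two terms are at most `logHarmonicError (N + 1) - d`, hence at most 0, and v(w - v)/2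
  -- ≤ w²/8 ≤ 1/(8N²).
  · nlinarith [sq_nonneg (2 * v - w)]

/-! ### Interval arithmetic for logarithmic means. -/

/-- The numerator of `2 ∑_{j < 7} M ^ (-(2 j + 1)) / (2 j + 1)` over `logDen M`. -/
def logNum (M : ℕ) : ℕ :=
  let Q := M * M
  2 * ((((((45045 * Q + 15015) * Q + 9009) * Q + 6435) * Q + 5005) * Q + 4095) * Q + 3465)

/-- The common denominator `45045 M ^ 13` of `2 ∑_{j < 7} M ^ (-(2 j + 1)) / (2 j + 1)`. -/
def logDen (M : ℕ) : ℕ :=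
  let Q := M * M
  let R := Q * Q * Q
  45045 * M * (R * R)

/-- A lower bound for `S * log ((N + 1) / N)`. -/
def logLower (S N : ℕ) : ℕ := S * logNum (2 * N + 1) / logDen (2 * N + 1)

/-- An upper bound for `S * log ((N + 1) / N)`. -/
def logUpper (S N : ℕ) : ℕ := logLower S N + 4 + 3 * (S / (2 * N + 1) ^ 15)

/-- The ratio (N+1)/N is (1+x)/(1-x) with x = 1/(2N+1), so seven terms of the artanh series apply.
The upper slack 4 + 3·(…) covers one unit of rounding and the tail. -/
theorem log_enclosure (S : ℕ) {N : ℕ} (hN : 1 ≤ N) :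
    (logLower S N : ℝ) ≤ S * Real.log (((N : ℝ) + 1) / N) ∧
    S * Real.log (((N : ℝ) + 1) / N) ≤ logUpper S N := by
  have hN0 : (1 : ℝ) ≤ N := by exact_mod_cast hN
  set M : ℝ := 2 * N + 1 with hM
  have hM3 : 3 ≤ M := by linarith
  have hx1 : 1 / M < 1 := by rw [div_lt_one (by linarith)]; linarith
  have hx0 : 0 ≤ 1 / M := by positivity
  have e : (1 + 1 / M) / (1 - 1 / M) = ((N : ℝ) + 1) / N := by
    have : 1 - 1 / M = 2 * N / M := by field_simp; rw [hM]; ring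
    rw [this, hM]
    field_simp
    ring
  have h1 := Real.sum_range_le_log_div hx0 hx1 7
  have h2 := Real.log_div_le_sum_range_add hx0 hx1 7
  rw [e] at h1 h2
  have hnum : ((logNum (2 * N + 1) : ℕ) : ℝ) / (logDen (2 * N + 1) : ℕ) =
      2 * ∑ i ∈ Finset.range 7, (1 / M) ^ (2 * i + 1) / (2 * (i : ℝ) + 1) := by
    simp only [logNum, logDen, Finset.sum_range_succ, Finset.sum_range_zero]
    push_cast
    rw [← hM]
    field_simp
    ring
  -- Since M ≥ 3, the factor is at most 2/(1 - 1/9) = 9/4.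
  have htail : 2 * ((1 / M) ^ (2 * 7 + 1) / (1 - (1 / M) ^ 2)) ≤ 9 / 4 * (1 / M) ^ 15 := by
    have hsq : (1 / M) ^ 2 ≤ 1 / 9 := by
      rw [div_pow, one_pow]
      exact one_div_le_one_div_of_le (by norm_num) (by nlinarith)
    have hp : 0 ≤ (1 / M) ^ 15 := by positivity
    norm_num only
    rw [mul_div_assoc', div_le_iff₀ (by linarith)]
    nlinarith
  have hS : (0 : ℝ) ≤ S := Nat.cast_nonneg S
  have hlow : (logLower S N : ℝ) ≤
      S * ((logNum (2 * N + 1) : ℕ) / (logDen (2 * N + 1) : ℕ) : ℝ) := by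
    rw [logLower, ← mul_div_assoc]
    exact_mod_cast Nat.cast_div_le
  have hlow' : S * ((logNum (2 * N + 1) : ℕ) / (logDen (2 * N + 1) : ℕ) : ℝ) ≤
      logLower S N + 1 := by
    have := (Nat.lt_floor_add_one
      (((S * logNum (2 * N + 1) : ℕ) : ℝ) / (logDen (2 * N + 1) : ℕ))).le
    rw [Nat.floor_div_eq_div] at this
    rw [logLower, ← mul_div_assoc]
    exact_mod_cast this
  have htl : (S : ℝ) * (1 / M) ^ 15 ≤ (S / (2 * N + 1) ^ 15 : ℕ) + 1 := by
    have := (Nat.lt_floor_add_one ((S : ℝ) / ((2 * N + 1) ^ 15 : ℕ))).le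
    rw [Nat.floor_div_eq_div] at this
    push_cast at this
    rwa [← hM, div_eq_mul_one_div, ← one_div_pow] at this
  rw [hnum] at hlow hlow'
  constructor
  · refine hlow.trans (mul_le_mul_of_nonneg_left (by linarith) hS)
  · have h3 : S * Real.log (((N : ℝ) + 1) / N) ≤
        S * (2 * ∑ i ∈ Finset.range 7, (1 / M) ^ (2 * i + 1) / (2 * (i : ℝ) + 1) +
          9 / 4 * (1 / M) ^ 15) := mul_le_mul_of_nonneg_left (by linarith) hS
    have h4 : (0 : ℝ) ≤ (S / (2 * N + 1) ^ 15 : ℕ) := Nat.cast_nonneg _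
    rw [logUpper]
    push_cast at h4 htl ⊢
    linarith

/-- Evaluates `n` before passing it on, which keeps kernel reduction of loops linear. -/
def forceNat {β : Type} (n : ℕ) (f : ℕ → β) : β :=
  match n with
  | 0 => f 0
  | m + 1 => f (m + 1)

theorem forceNat_eq {β : Type} (n : ℕ) (f : ℕ → β) : forceNat n f = f n := by
  cases n <;> rfl

def forceInt {β : Type} (z : ℤ) (f : ℤ → β) : β :=
  match z with
  | .ofNat n => forceNat n fun n => f (.ofNat n)
  | .negSucc n => forceNat n fun n => f (.negSucc n)

theorem forceInt_eq {β : Type} (z : ℤ) (f : ℤ → β) : forceInt z f = f z := by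
  cases z <;> simp only [forceInt, forceNat_eq]

/-- Lower bound for `a * l` with `l ∈ [l1, l2]`, `0 ≤ l1`. -/
def mulLower (a : ℤ) (l1 l2 : ℕ) : ℤ :=
  match a with
  | .ofNat n => .ofNat (n * l1)
  | .negSucc n => .negSucc n * .ofNat l2

/-- Upper bound for `a * l` with `l ∈ [l1, l2]`, `0 ≤ l1`. -/
def mulUpper (a : ℤ) (l1 l2 : ℕ) : ℤ :=
  match a with
  | .ofNat n => .ofNat (n * l2)
  | .negSucc n => .negSucc n * .ofNat l1

theorem mulLower_le {S A L : ℝ} {a : ℤ} {l1 l2 : ℕ} (ha : a ≤ S * A) (h1 : l1 ≤ S * L)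
    (h2 : S * L ≤ l2) : (mulLower a l1 l2 : ℝ) ≤ S * (S * (A * L)) := by
  have hl : (0 : ℝ) ≤ l1 := Nat.cast_nonneg _
  have e : S * (S * (A * L)) = (S * A) * (S * L) := by ring
  rw [e]
  cases a with
  | ofNat n =>
    have hn : (0 : ℝ) ≤ n := Nat.cast_nonneg _
    simp only [mulLower, Int.ofNat_eq_natCast, Int.cast_natCast] at ha ⊢
    push_cast
    nlinarith
  | negSucc n =>
    have hn : ((Int.negSucc n : ℤ) : ℝ) ≤ 0 := by exact_mod_cast (Int.negSucc_lt_zero n).le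
    simp only [mulLower, Int.ofNat_eq_natCast]
    rw [Int.cast_mul, Int.cast_natCast]
    nlinarith

theorem le_mulUpper {S A L : ℝ} {a : ℤ} {l1 l2 : ℕ} (ha : S * A ≤ a) (h1 : l1 ≤ S * L)
    (h2 : S * L ≤ l2) : S * (S * (A * L)) ≤ (mulUpper a l1 l2 : ℝ) := by
  have hl : (0 : ℝ) ≤ l1 := Nat.cast_nonneg _
  have e : S * (S * (A * L)) = (S * A) * (S * L) := by ring
  rw [e]
  cases a with
  | ofNat n =>
    have hn : (0 : ℝ) ≤ n := Nat.cast_nonneg _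
    simp only [mulUpper, Int.ofNat_eq_natCast, Int.cast_natCast] at ha ⊢
    push_cast
    nlinarith
  | negSucc n =>
    have hn : ((Int.negSucc n : ℤ) : ℝ) ≤ 0 := by exact_mod_cast (Int.negSucc_lt_zero n).le
    simp only [mulUpper, Int.ofNat_eq_natCast]
    rw [Int.cast_mul, Int.cast_natCast]
    nlinarith

/-- `[a1, a2] / S` and `[w1, w2] / S` contain `A` and `W`. -/
structure Encloses (S : ℕ) (A W : ℝ) (a1 a2 w1 w2 : ℤ) : Prop where
  a_lower : a1 ≤ S * A
  a_upper : S * A ≤ a2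
  w_lower : w1 ≤ S * W
  w_upper : S * W ≤ w2

/-- Interval version of `(A, W) ↦ (A + x / (N + 1), W + A * log ((N + 1) / N))`. -/
def walk {β : Type} (S : ℕ) (x : ℤ) (N : ℕ) (a1 a2 w1 w2 : ℤ) (k : ℤ → ℤ → ℤ → ℤ → β) : β :=
  forceNat (logLower S N) fun l1 =>
  forceNat (logUpper S N) fun l2 =>
  -- Integer division rounds down, so lower ends need no correction and upper ends get + 1.
  forceInt (w1 + mulLower a1 l1 l2 / S) fun w1' =>
  forceInt (w2 + mulUpper a2 l1 l2 / S + 1) fun w2' =>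
  forceInt (S * x / (N + 1)) fun b =>
  forceInt (a1 + b) fun a1' =>
  forceInt (a2 + b + 1) fun a2' =>
  k a1' a2' w1' w2'

theorem int_ediv_bounds (x : ℤ) {y : ℤ} (hy : 0 < y) :
    ((x / y : ℤ) : ℝ) ≤ x / y ∧ (x : ℝ) / y ≤ (x / y : ℤ) + 1 := by
  have hy' : (0 : ℝ) < y := by exact_mod_cast hy
  constructor
  · rw [le_div_iff₀ hy']
    exact_mod_cast Int.ediv_mul_le x hy.ne'
  · rw [div_le_iff₀ hy']
    exact_mod_cast (Int.lt_ediv_add_one_mul_self x hy).le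

theorem walk_spec {β : Type} {S : ℕ} (hS : 0 < S) (x : ℤ) {N : ℕ} (hN : 1 ≤ N) {A W : ℝ}
    {a1 a2 w1 w2 : ℤ} (h : Encloses S A W a1 a2 w1 w2) (k : ℤ → ℤ → ℤ → ℤ → β) :
    ∃ a1' a2' w1' w2', walk S x N a1 a2 w1 w2 k = k a1' a2' w1' w2' ∧
      Encloses S (A + x / ((N : ℝ) + 1)) (W + A * Real.log (((N : ℝ) + 1) / N))
        a1' a2' w1' w2' := by
  simp only [walk, forceNat_eq, forceInt_eq]
  refine ⟨_, _, _, _, rfl, ?_⟩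
  obtain ⟨hl1, hl2⟩ := log_enclosure S hN
  have hS' : (0 : ℝ) < S := by exact_mod_cast hS
  have hSz : (0 : ℤ) < S := by exact_mod_cast hS
  set L := Real.log (((N : ℝ) + 1) / N)
  have b1 := mulLower_le h.a_lower hl1 hl2
  have b2 := le_mulUpper h.a_upper hl1 hl2
  obtain ⟨c1, -⟩ := int_ediv_bounds (mulLower a1 (logLower S N) (logUpper S N)) hSz
  obtain ⟨-, c2⟩ := int_ediv_bounds (mulUpper a2 (logLower S N) (logUpper S N)) hSz
  obtain ⟨d1, d2⟩ := int_ediv_bounds (S * x) (y := (N : ℤ) + 1) (by positivity)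
  have e1 : (mulLower a1 (logLower S N) (logUpper S N) : ℝ) / (S : ℤ) ≤ S * (A * L) := by
    rw [div_le_iff₀ (by exact_mod_cast hS')]; push_cast; linarith
  have e2 : S * (A * L) ≤ (mulUpper a2 (logLower S N) (logUpper S N) : ℝ) / (S : ℤ) := by
    rw [le_div_iff₀ (by exact_mod_cast hS')]; push_cast; linarith
  have e3 : S * (x / ((N : ℝ) + 1)) = ((S * x : ℤ) : ℝ) / ((N : ℤ) + 1 : ℤ) := by
    push_cast; ring
  have := h.a_lower
  have := h.a_upper
  have := h.w_lower
  have := h.w_upper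
  constructor <;> push_cast only [mul_add, Int.cast_add, Int.cast_one] <;> linarith

/-! ### Computed values of μ and verification of M_1 up to 8192. -/

/-- The Möbius function of `r`, by trial division by the primes in the list. -/
def moebiusTrial : List ℕ → ℕ → ℤ
  | [], r => match r with
    | 1 => 1
    | _ => -1
  | p :: ps, r => match r % p with
    | 0 => forceNat (r / p) fun s => match s % p with
      | 0 => 0
      | _ + 1 => match moebiusTrial ps s with
        | .ofNat 0 => 0
        | .ofNat (_ + 1) => -1
        | .negSucc _ => 1
    | _ + 1 => moebiusTrial ps r

/-- A cofactor below B² whose prime factors are all at least B is 1 or a prime, which justifies the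
empty-list case. -/
theorem moebiusTrial_eq {B : ℕ} (l : List ℕ) (hl : ∀ p ∈ l, p.Prime) (r : ℕ) (hr0 : r ≠ 0)
    (hrB : r < B ^ 2) (hr : ∀ q, q.Prime → q ∣ r → q ∈ l ∨ B ≤ q) : moebiusTrial l r = μ r := by
  induction l generalizing r with
  | nil =>
    by_cases h1 : r = 1
    · subst h1; simp [moebiusTrial]
    · have hp : r.Prime := by
        by_contra hp
        have h2 := Nat.minFac_sq_le_self (Nat.pos_of_ne_zero hr0) hp
        have h3 := hr _ (Nat.minFac_prime h1) (Nat.minFac_dvd r)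
        simp only [List.not_mem_nil, false_or] at h3
        have := Nat.pow_le_pow_left h3 2
        lia
      rw [ArithmeticFunction.moebius_apply_prime hp]
      unfold moebiusTrial
      split
      · exact absurd rfl h1
      · rfl
  | cons p ps ih =>
    have hp : p.Prime := hl p (by simp)
    have hps : ∀ q ∈ ps, q.Prime := fun q hq => hl q (by simp [hq])
    unfold moebiusTrial
    split
    · rename_i h0
      obtain ⟨s, rfl⟩ := Nat.dvd_of_mod_eq_zero h0
      rw [forceNat_eq, Nat.mul_div_cancel_left s hp.pos]
      have hs0 : s ≠ 0 := by rintro rfl; simp at hr0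
      split
      · rename_i h0
        obtain ⟨t, rfl⟩ := Nat.dvd_of_mod_eq_zero h0
        rw [ArithmeticFunction.moebius_eq_zero_of_not_squarefree]
        intro h
        exact hp.not_isUnit (h p ⟨t, by ring⟩)
      · rename_i h0
        have hps' : ¬ p ∣ s := fun h => by
          rw [Nat.mod_eq_zero_of_dvd h] at h0; simp at h0
        rw [ArithmeticFunction.isMultiplicative_moebius.map_mul_of_coprime
          ((Nat.Prime.coprime_iff_not_dvd hp).2 hps'),
          ArithmeticFunction.moebius_apply_prime hp]
        have := ih hps s hs0 ((Nat.le_mul_of_pos_left s hp.pos).trans_lt hrB) fun q hq hqs => by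
          rcases hr q hq (hqs.mul_left p) with h | h
          · rcases List.mem_cons.1 h with rfl | h
            · exact absurd hqs hps'
            · exact Or.inl h
          · exact Or.inr h
        rw [this]
        have hb := ArithmeticFunction.abs_moebius_le_one (n := s)
        rw [abs_le] at hb
        split
        · rename_i h; rw [h]; rfl
        · rename_i n h
          rw [h, Int.ofNat_eq_natCast] at hb ⊢
          push_cast at hb ⊢
          lia
        · rename_i n h
          rw [h] at hb ⊢
          have : n = 0 := by
            have := hb.1
            rw [Int.negSucc_eq] at this
            lia
          subst this
          rfl
    · rename_i h0
      refine ih hps r hr0 hrB fun q hq hqr => ?_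
      rcases hr q hq hqr with h | h
      · rcases List.mem_cons.1 h with rfl | h
        · rw [Nat.mod_eq_zero_of_dvd hqr] at h0; simp at h0
        · exact Or.inl h
      · exact Or.inr h

def primesBelow97 : List ℕ :=
  [2, 3, 5, 7, 11, 13, 17, 19, 23, 29, 31, 37, 41, 43, 47, 53, 59, 61, 67, 71, 73, 79, 83, 89]

theorem moebiusTrial_primesBelow97 {n : ℕ} (h0 : n ≠ 0) (h : n < 9409) :
    moebiusTrial primesBelow97 n = μ n := by
  refine moebiusTrial_eq (B := 97) _ (by simp [primesBelow97]; norm_num) n h0 (by norm_num; lia)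
    fun q hq _ => ?_
  by_contra! hc
  obtain ⟨h1, h2⟩ := hc
  revert h1 hq
  interval_cases q <;> simp [primesBelow97] <;> norm_num

/-- Iterates a partial function `2 ^ d` times, with recursion depth `d`. -/
def iterateTwoPow {α : Type} (step : α → Option α) : ℕ → α → Option α
  | 0, s => step s
  | d + 1, s =>
    match iterateTwoPow step d s with
    | some t => iterateTwoPow step d t
    | none => none

theorem iterateTwoPow_spec {α : Type} {step : α → Option α} {I : ℕ → α → Prop} {Q : ℕ → Prop}
    {B : ℕ} (hstep : ∀ n s t, n < B → I n s → step s = some t → I (n + 1) t ∧ Q n) (d : ℕ) :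
    ∀ n s t, n + 2 ^ d ≤ B → I n s → iterateTwoPow step d s = some t →
      I (n + 2 ^ d) t ∧ ∀ m, n ≤ m → m < n + 2 ^ d → Q m := by
  induction d with
  | zero =>
    intro n s t hB hI h
    obtain ⟨h1, h2⟩ := hstep n s t (by lia) hI h
    refine ⟨h1, fun m hm hm' => ?_⟩
    obtain rfl : m = n := by lia
    exact h2
  | succ d ih =>
    intro n s t hB hI h
    have hp : 2 ^ (d + 1) = 2 ^ d + 2 ^ d := by ring
    rw [iterateTwoPow] at h
    split at h
    · rename_i u hu
      obtain ⟨h1, h2⟩ := ih n s u (by lia) hI hu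
      obtain ⟨h3, h4⟩ := ih (n + 2 ^ d) u t (by lia) h1 h
      refine ⟨by rwa [hp, ← add_assoc], fun m hm hm' => ?_⟩
      rcases lt_or_ge m (n + 2 ^ d) with hlt | hge
      · exact h2 m hm hlt
      · exact h4 m hge (by lia)
    · simp at h

/-- A point of a walk together with enclosures of the summatory functions at this point. -/
structure WalkState where
  N : ℕ
  a1 : ℤ
  a2 : ℤ
  w1 : ℤ
  w2 : ℤ

/-- Checks the size of `∑_{n ≤ N} μ n / n * log (N / n)` and proceeds to `N + 1`. -/
def moebiusStep (S : ℕ) : WalkState → Option WalkState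
  | ⟨N, a1, a2, w1, w2⟩ =>
    -- The values at 1 and 2 are 0 and log 2, both below 0.85.
    match decide ((if N ≤ 2 then 0 else 85 * S : ℤ) ≤ 100 * w1) &&
      decide (100000 * w2 ≤ 100303 * S) with
    | true =>
      walk S (moebiusTrial primesBelow97 (N + 1)) N a1 a2 w1 w2 fun a1' a2' w1' w2' =>
        forceNat (N + 1) fun N' => some ⟨N', a1', a2', w1', w2'⟩
    | false => none

theorem moebiusStep_spec {S : ℕ} (hS : 0 < S) {n : ℕ} (hn : n < 9000) {s t : WalkState}
    (hs : 1 ≤ n ∧ s.N = n ∧ Encloses S (harmSum (μ : ArithmeticFunction ℝ) n)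
      (wsum (μ : ArithmeticFunction ℝ) Real.log n) s.a1 s.a2 s.w1 s.w2)
    (hst : moebiusStep S s = some t) :
    (1 ≤ n + 1 ∧ t.N = n + 1 ∧ Encloses S (harmSum (μ : ArithmeticFunction ℝ) (n + 1))
      (wsum (μ : ArithmeticFunction ℝ) Real.log (n + 1 : ℕ)) t.a1 t.a2 t.w1 t.w2) ∧
    (if n ≤ 2 then 0 else 0.85) ≤ wsum (μ : ArithmeticFunction ℝ) Real.log n ∧
    wsum (μ : ArithmeticFunction ℝ) Real.log n ≤ 1.00303 := by
  obtain ⟨N, a1, a2, w1, w2⟩ := s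
  obtain ⟨hn1, rfl, h⟩ := hs
  dsimp only at hn hn1 h ⊢
  rw [moebiusStep] at hst
  split at hst
  · rename_i hc
    rw [Bool.and_eq_true, decide_eq_true_iff, decide_eq_true_iff] at hc
    obtain ⟨c1, c2⟩ := hc
    have hS' : (0 : ℝ) < S := by exact_mod_cast hS
    obtain ⟨a1', a2', w1', w2', e, hE⟩ :=
      walk_spec hS (moebiusTrial primesBelow97 (N + 1)) hn1 h
        fun a1' a2' w1' w2' => forceNat (N + 1) fun N' =>
          some (⟨N', a1', a2', w1', w2'⟩ : WalkState)
    rw [e, forceNat_eq, Option.some.injEq] at hst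
    subst hst
    rw [moebiusTrial_primesBelow97 (by lia) (by lia)] at hE
    refine ⟨⟨by lia, rfl, ?_⟩, ?_⟩
    · rw [wsum_log_succ _ hn1, harmSum_succ]
      exact hE
    · have c1' : ((if N ≤ 2 then 0 else 85 * S : ℤ) : ℝ) ≤ 100 * w1 := by exact_mod_cast c1
      have c2' : 100000 * (w2 : ℝ) ≤ 100303 * S := by exact_mod_cast c2
      have := h.w_lower
      have := h.w_upper
      constructor
      · split_ifs at c1' ⊢
        · push_cast at c1'; nlinarith
        · push_cast at c1'; nlinarith
      · nlinarith
  · simp at hst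

theorem iterate_moebiusStep_isSome : (iterateTwoPow (moebiusStep 10000000000000) 13
    ⟨1, 10000000000000, 10000000000000, 0, 0⟩).isSome = true := by
  decide +kernel

theorem wsum_moebius_log_bounds_of_le {n : ℕ} (h1 : 1 ≤ n) (h2 : n ≤ 8192) :
    (if n ≤ 2 then 0 else 0.85) ≤ wsum (μ : ArithmeticFunction ℝ) Real.log n ∧
    wsum (μ : ArithmeticFunction ℝ) Real.log n ≤ 1.00303 := by
  obtain ⟨t, ht⟩ := Option.isSome_iff_exists.1 iterate_moebiusStep_isSome
  refine (iterateTwoPow_spec (fun n s t hn hs hst => moebiusStep_spec (by norm_num) hn hs hst) 13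
    1 _ t (by norm_num) ⟨le_rfl, rfl, ?_⟩ ht).2 n h1 (by norm_num; lia)
  rw [wsum_log_one]
  constructor <;> simp [harmSum]

/-! ### The mollifier and its error function. -/

/-- The arithmetic function supported on the first entries of the list, with the second entries
as values. -/
def listCoef (l : List (ℕ × ℤ)) (n : ℕ) : ℤ :=
  (l.map fun p => if p.1 = n then p.2 else 0).sum

/-- The divisor sum of `listCoef l`. -/
def listDivSum (l : List (ℕ × ℤ)) (n : ℕ) : ℤ :=
  (l.map fun p => if n % p.1 = 0 then p.2 else 0).sum

theorem sum_listCoef_mul (l : List (ℕ × ℤ)) (G : ℕ → ℝ) (s : Finset ℕ) (h : ∀ p ∈ l, p.1 ∈ s) :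
    ∑ n ∈ s, (listCoef l n : ℝ) * G n = (l.map fun p => (p.2 : ℝ) * G p.1).sum := by
  induction l with
  | nil => simp [listCoef]
  | cons p l ih =>
    have hp : p.1 ∈ s := h p (by simp)
    have := ih fun q hq => h q (by simp [hq])
    simp only [listCoef, List.map_cons, List.sum_cons, Int.cast_add, add_mul,
      Finset.sum_add_distrib] at this ⊢
    rw [this]
    simp [hp]

theorem sum_divisors_listCoef (l : List (ℕ × ℤ)) {n : ℕ} (hn : n ≠ 0) :
    ∑ d ∈ n.divisors, listCoef l d = listDivSum l n := by
  induction l with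
  | nil => simp [listCoef, listDivSum]
  | cons p l ih =>
    simp only [listCoef, listDivSum, List.map_cons, List.sum_cons,
      Finset.sum_add_distrib] at ih ⊢
    rw [ih]
    simp [hn, Nat.dvd_iff_mod_eq_zero]

theorem listCoef_eq_zero {l : List (ℕ × ℤ)} {n : ℕ} (h : ∀ p ∈ l, p.1 ≠ n) : listCoef l n = 0 := by
  induction l with
  | nil => rfl
  | cons p l ih =>
    have h1 := h p (by simp)
    have h2 := ih fun q hq => h q (by simp [hq])
    simp only [listCoef, List.map_cons, List.sum_cons] at h2 ⊢
    rw [h2, if_neg h1, add_zero]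

/-- Coefficients of a smoothed truncation of the Möbius function. -/
def mollifier : List (ℕ × ℤ) :=
  [(1, 1000000), (2, -1000000), (3, -1000002), (5, -999830), (6, 999204), (7, -999047),
    (10, 929260), (11, -963655), (13, -386373), (14, 482762), (15, 348900), (17, -353515),
    (19, -194104), (21, 141687), (22, 266816), (23, -269560)]

theorem mem_Ioc_of_mem_mollifier {p : ℕ × ℤ} (hp : p ∈ mollifier) : p.1 ∈ Finset.Ioc 0 23 := by
  revert p
  decide

/-- The arithmetic function with values given by `mollifier`. -/
noncomputable def mollifierFun : ArithmeticFunction ℝ :=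
  ⟨fun n => (listCoef mollifier n : ℝ), by
    rw [listCoef_eq_zero fun p hp => by
      have := (Finset.mem_Ioc.1 (mem_Ioc_of_mem_mollifier hp)).1; lia]
    simp⟩

theorem mollifierFun_apply (n : ℕ) : mollifierFun n = listCoef mollifier n := rfl

theorem sum_Ioc_mollifierFun (G : ℕ → ℝ) {N : ℕ} (hN : 23 ≤ N) :
    ∑ n ∈ Finset.Ioc 0 N, mollifierFun n * G n = ∑ n ∈ Finset.Ioc 0 23, mollifierFun n * G n := by
  symm
  refine Finset.sum_subset (Finset.Ioc_subset_Ioc_right hN) fun n _ hn => ?_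
  rw [mollifierFun_apply, listCoef_eq_zero]
  · simp
  · rintro p hp rfl
    exact hn (mem_Ioc_of_mem_mollifier hp)

theorem mollifierFun_mul_zeta {n : ℕ} (hn : n ≠ 0) :
    (mollifierFun * (ζ : ArithmeticFunction ℝ)) n = listDivSum mollifier n := by
  rw [ArithmeticFunction.coe_mul_zeta_apply, ← sum_divisors_listCoef _ hn]
  push_cast
  rfl

/-- This cancellation must be exact: it removes the log² term from the mean of c * ζ and makes the
mean of c constant from 23 on. -/
theorem sum_mollifierFun_div : ∑ n ∈ Finset.Ioc 0 23, mollifierFun n * (1 / (n : ℝ)) = 0 := by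
  rw [show (∑ n ∈ Finset.Ioc 0 23, mollifierFun n * (1 / (n : ℝ))) = _ from
    sum_listCoef_mul mollifier (fun n => 1 / (n : ℝ)) _ fun _ => mem_Ioc_of_mem_mollifier]
  simp only [mollifier, List.map_cons, List.sum_cons, List.map_nil, List.sum_nil]
  norm_num

theorem sum_abs_mollifierFun_mul :
    ∑ n ∈ Finset.Ioc 0 23, |mollifierFun n| * (n : ℝ) ≤ 85638521 := by
  have h : ∀ n ∈ Finset.Ioc 0 23, |mollifierFun n| * (n : ℝ) =
      ((|listCoef mollifier n| * n : ℤ) : ℝ) := fun n _ => by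
    push_cast; rfl
  rw [Finset.sum_congr rfl h, ← Int.cast_sum]
  exact_mod_cast (by decide +kernel :
    ∑ n ∈ Finset.Ioc 0 23, |listCoef mollifier n| * (n : ℤ) ≤ 85638521)

/-- The logarithmic slope `-∑ c n / n * log n` of the mollifier. -/
noncomputable def mollifierSlope : ℝ :=
  -∑ n ∈ Finset.Ioc 0 23, mollifierFun n * (Real.log n / n)

theorem wsum_mollifierFun_log {N : ℕ} (hN : 23 ≤ N) :
    wsum mollifierFun Real.log N = mollifierSlope := by
  have hN0 : (0 : ℝ) < N := by exact_mod_cast (by lia : 0 < N)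
  have h : ∀ n ∈ Finset.Ioc 0 N, mollifierFun n / n * Real.log (N / n) =
      mollifierFun n * (1 / n * Real.log N - Real.log n / n) := fun n hn => by
    have : (0 : ℝ) < n := by exact_mod_cast (Finset.mem_Ioc.1 hn).1
    rw [Real.log_div hN0.ne' this.ne']
    ring
  rw [wsum, Nat.floor_natCast, Finset.sum_congr rfl h, sum_Ioc_mollifierFun _ hN, mollifierSlope]
  simp only [mul_sub, ← mul_assoc]
  rw [Finset.sum_sub_distrib, ← Finset.sum_mul, sum_mollifierFun_div]
  ring

/-- The deviation of `∑_{n ≤ y} (c * 1) n / n * log (y / n)` from its main term. -/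
noncomputable def mollifierError (y : ℝ) : ℝ :=
  wsum (mollifierFun * (ζ : ArithmeticFunction ℝ)) Real.log y - mollifierSlope * Real.log y

/-- Insert the quadratic approximation at y/n and sum against c(n)/n. The log² y and d terms cancel,
the log y coefficient is the slope, and the remaining constant is δ. -/
theorem exists_mollifierError_bound : ∃ δ : ℝ, ∀ y : ℝ, 401 ≤ y →
    |mollifierError y - δ| ≤ 12050000 / y ^ 2 := by
  obtain ⟨d, -, -, hd⟩ := exists_wsum_zeta_log_bound
  refine ⟨Real.eulerMascheroniConstant * mollifierSlope +
    ∑ n ∈ Finset.Ioc 0 23, mollifierFun n * (Real.log n ^ 2 / (2 * n)), fun y hy => ?_⟩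
  have hy0 : 0 < y := by linarith
  have hfl : 23 ≤ ⌊y⌋₊ := Nat.le_floor (by norm_num; linarith)
  set P : ℝ → ℝ := fun u => Real.log u ^ 2 / 2 + Real.eulerMascheroniConstant * Real.log u + d
    with hP
  have e1 : wsum (mollifierFun * (ζ : ArithmeticFunction ℝ)) Real.log y =
      ∑ n ∈ Finset.Ioc 0 23, mollifierFun n *
        (1 / n * wsum (ζ : ArithmeticFunction ℝ) Real.log (y / n)) := by
    rw [wsum_mul, ← sum_Ioc_mollifierFun _ hfl]
    exact Finset.sum_congr rfl fun n _ => by ring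
  have e2 : ∑ n ∈ Finset.Ioc 0 23, mollifierFun n * (1 / n * P (y / n)) =
      mollifierSlope * Real.log y + (Real.eulerMascheroniConstant * mollifierSlope +
        ∑ n ∈ Finset.Ioc 0 23, mollifierFun n * (Real.log n ^ 2 / (2 * n))) := by
    have h : ∀ n ∈ Finset.Ioc 0 23, mollifierFun n * (1 / n * P (y / n)) =
        mollifierFun n * (1 / n) * P y -
        mollifierFun n * (Real.log n / n) * (Real.log y + Real.eulerMascheroniConstant) +
        mollifierFun n * (Real.log n ^ 2 / (2 * n)) := fun n hn => by
      have : (0 : ℝ) < n := by exact_mod_cast (Finset.mem_Ioc.1 hn).1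
      simp only [hP]
      rw [Real.log_div hy0.ne' this.ne']
      field_simp
      ring
    rw [Finset.sum_congr rfl h, Finset.sum_add_distrib, Finset.sum_sub_distrib, ← Finset.sum_mul,
      ← Finset.sum_mul, sum_mollifierFun_div, mollifierSlope]
    ring
  have e3 : mollifierError y - (Real.eulerMascheroniConstant * mollifierSlope +
      ∑ n ∈ Finset.Ioc 0 23, mollifierFun n * (Real.log n ^ 2 / (2 * n))) =
      ∑ n ∈ Finset.Ioc 0 23, mollifierFun n *
        (1 / n * (wsum (ζ : ArithmeticFunction ℝ) Real.log (y / n) - P (y / n))) := by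
    simp only [mul_sub]
    rw [Finset.sum_sub_distrib, e2, ← e1, mollifierError]
    ring
  rw [e3]
  refine (Finset.abs_sum_le_sum_abs _ _).trans ?_
  have h : ∀ n ∈ Finset.Ioc 0 23, |mollifierFun n *
      (1 / n * (wsum (ζ : ArithmeticFunction ℝ) Real.log (y / n) - P (y / n)))| ≤
      |mollifierFun n| * n * ((401 / 378) ^ 2 / 8 / y ^ 2) := fun n hn => by
    have hn0 : (0 : ℝ) < n := by exact_mod_cast (Finset.mem_Ioc.1 hn).1
    have hn23 : (n : ℝ) ≤ 23 := by exact_mod_cast (Finset.mem_Ioc.1 hn).2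
    have hu : 1 ≤ y / n := by rw [le_div_iff₀ hn0]; linarith
    -- Here y/n ≥ 401/23, so the loss of 1 in the floor is at most the fraction 23/401.
    have hf : 378 / 401 * (y / n) ≤ (⌊y / n⌋₊ : ℝ) := by
      have h1 := (Nat.lt_floor_add_one (y / n)).le
      have h2 : 1 ≤ 23 / 401 * (y / n) := by
        rw [mul_div_assoc', le_div_iff₀ hn0]; linarith
      linarith
    have hpos : 0 < 378 / 401 * (y / n) := by positivity
    rw [abs_mul, abs_mul, abs_of_nonneg (by positivity : (0 : ℝ) ≤ 1 / n), mul_assoc]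
    refine mul_le_mul_of_nonneg_left ?_ (abs_nonneg _)
    calc 1 / (n : ℝ) * |wsum (ζ : ArithmeticFunction ℝ) Real.log (y / n) - P (y / n)|
        ≤ 1 / n * (1 / (8 * (⌊y / n⌋₊ : ℝ) ^ 2)) := by gcongr; exact hd _ hu
      _ ≤ 1 / n * (1 / (8 * (378 / 401 * (y / n)) ^ 2)) := by gcongr
      _ = _ := by field_simp
  refine (Finset.sum_le_sum h).trans ?_
  rw [← Finset.sum_mul]
  have hy2 : 0 < y ^ 2 := by positivity
  calc _ ≤ 85638521 * ((401 / 378) ^ 2 / 8 / y ^ 2) := by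
        gcongr; exact sum_abs_mollifierFun_mul
    _ = (85638521 * ((401 / 378) ^ 2 / 8)) / y ^ 2 := by ring
    _ ≤ _ := by gcongr; norm_num

/-- On [N, N + 1] the error is affine in log y, so its absolute value is largest at an end. -/
theorem abs_mollifierError_le {N : ℕ} (hN : 1 ≤ N) {y : ℝ} (h1 : (N : ℝ) ≤ y) (h2 : y ≤ N + 1) :
    |mollifierError y| ≤ max |mollifierError N| |mollifierError (N + 1 : ℕ)| := by
  have hN0 : (0 : ℝ) < N := by exact_mod_cast hN
  have e : ∀ z : ℝ, (N : ℝ) ≤ z → z ≤ N + 1 → mollifierError z = mollifierError N +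
      (harmSum (mollifierFun * (ζ : ArithmeticFunction ℝ)) N - mollifierSlope) *
        Real.log (z / N) := fun z hz1 hz2 => by
    rw [mollifierError, wsum_log_eq _ hN hz1 hz2, mollifierError,
      Real.log_div (by linarith) hN0.ne']
    ring
  have e1 := e ((N + 1 : ℕ) : ℝ) (by push_cast; linarith) (by push_cast; linarith)
  have a1 := abs_le.1 (le_max_left |mollifierError N| |mollifierError (N + 1 : ℕ)|)
  have a2 := abs_le.1 (le_max_right |mollifierError N| |mollifierError (N + 1 : ℕ)|)
  generalize max |mollifierError N| |mollifierError (N + 1 : ℕ)| = B at a1 a2 ⊢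
  rw [e1] at a2
  push_cast at a2
  rw [e y h1 h2, abs_le]
  exact ⟨le_of_linear_log hN0 h1 h2 a1.1 a2.1, linear_log_le hN0 h1 h2 a1.2 a2.2⟩

/-! ### Computed enclosures of the slope and of the error up to 401. -/

/-- Walks along the partial sums of `listCoef mollifier` and checks the final enclosure. -/
def checkSlope (S : ℕ) (lo hi : ℤ) : ℕ → ℕ → ℤ → ℤ → ℤ → ℤ → Bool
  | 0, _, _, _, w1, w2 => decide (lo ≤ w1) && decide (w2 ≤ hi)
  | fuel + 1, N, a1, a2, w1, w2 =>
    walk S (listCoef mollifier (N + 1)) N a1 a2 w1 w2 fun a1' a2' w1' w2' =>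
      forceNat (N + 1) fun N' => checkSlope S lo hi fuel N' a1' a2' w1' w2'

theorem checkSlope_spec {S : ℕ} (hS : 0 < S) {lo hi : ℤ} (fuel N : ℕ) (hN : 1 ≤ N)
    {a1 a2 w1 w2 : ℤ}
    (h : Encloses S (harmSum mollifierFun N) (wsum mollifierFun Real.log N) a1 a2 w1 w2)
    (hc : checkSlope S lo hi fuel N a1 a2 w1 w2 = true) :
    lo ≤ S * wsum mollifierFun Real.log (N + fuel : ℕ) ∧
    S * wsum mollifierFun Real.log (N + fuel : ℕ) ≤ hi := by
  induction fuel generalizing N a1 a2 w1 w2 with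
  | zero =>
    rw [checkSlope, Bool.and_eq_true, decide_eq_true_iff, decide_eq_true_iff] at hc
    have c1 : (lo : ℝ) ≤ w1 := by exact_mod_cast hc.1
    have c2 : (w2 : ℝ) ≤ hi := by exact_mod_cast hc.2
    exact ⟨c1.trans h.w_lower, h.w_upper.trans c2⟩
  | succ fuel ih =>
    rw [checkSlope] at hc
    obtain ⟨a1', a2', w1', w2', e, hE⟩ := walk_spec hS (listCoef mollifier (N + 1)) hN h
      fun a1' a2' w1' w2' => forceNat (N + 1) fun N' => checkSlope S lo hi fuel N' a1' a2' w1' w2'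
    rw [e, forceNat_eq] at hc
    have := ih (N + 1) (by lia) (by rw [wsum_log_succ _ hN, harmSum_succ]; exact hE) hc
    rwa [show N + 1 + fuel = N + (fuel + 1) by ring] at this

/-- Accumulates an upper bound for `∑ max |F k| |F (k + 1)| * (1 / k + (k + 1) / X)` along
`F = mollifierError`, and compares it together with the last `|F k|` with `bound`. -/
def checkError (S X bound : ℕ) : ℕ → ℕ → ℤ → ℤ → ℤ → ℤ → ℕ → Bool
  | 0, _, _, _, w1, w2, acc => Nat.ble (acc + max w1.natAbs w2.natAbs) bound
  | fuel + 1, N, a1, a2, w1, w2, acc =>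
    walk S (listDivSum mollifier (N + 1)) N a1 a2 w1 w2 fun a1' a2' w1' w2' =>
      forceNat (max (max w1.natAbs w2.natAbs) (max w1'.natAbs w2'.natAbs)) fun g =>
      forceNat (N + 1) fun N' =>
      forceNat (acc + g * (X + N * N') / (N * X) + 1) fun acc' =>
      checkError S X bound fuel N' a1' a2' w1' w2' acc'

theorem abs_le_max_natAbs {x : ℝ} {w1 w2 : ℤ} (h1 : w1 ≤ x) (h2 : x ≤ w2) :
    |x| ≤ (max w1.natAbs w2.natAbs : ℕ) := by
  have e1 : ((w1.natAbs : ℕ) : ℝ) = |(w1 : ℝ)| := by rw [Nat.cast_natAbs, Int.cast_abs]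
  have e2 : ((w2.natAbs : ℕ) : ℝ) = |(w2 : ℝ)| := by rw [Nat.cast_natAbs, Int.cast_abs]
  rw [Nat.cast_max, e1, e2]
  exact abs_le_max_abs_abs h1 h2

theorem mollifierError_encloses {S N : ℕ} (hN : 1 ≤ N) {A W : ℝ} {a1 a2 w1 w2 : ℤ}
    (hA : A = harmSum (mollifierFun * (ζ : ArithmeticFunction ℝ)) N - mollifierSlope)
    (hW : W = mollifierError N)
    (h : Encloses S (A + listDivSum mollifier (N + 1) / ((N : ℝ) + 1))
      (W + A * Real.log (((N : ℝ) + 1) / N)) a1 a2 w1 w2) :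
    Encloses S (harmSum (mollifierFun * (ζ : ArithmeticFunction ℝ)) (N + 1) - mollifierSlope)
      (mollifierError (N + 1 : ℕ)) a1 a2 w1 w2 := by
  have hN0 : (0 : ℝ) < N := by exact_mod_cast hN
  convert h using 1
  · rw [hA, harmSum_succ, mollifierFun_mul_zeta (by lia)]
    ring
  · rw [hA, hW, mollifierError, wsum_log_succ _ hN, mollifierError,
      Real.log_div (by positivity) hN0.ne']
    push_cast
    ring

theorem checkError_spec {S X bound : ℕ} (hS : 0 < S) (hX : 0 < X) (fuel N : ℕ) (hN : 1 ≤ N)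
    {a1 a2 w1 w2 : ℤ} (acc : ℕ)
    (h : Encloses S (harmSum (mollifierFun * (ζ : ArithmeticFunction ℝ)) N - mollifierSlope)
      (mollifierError N) a1 a2 w1 w2)
    (hc : checkError S X bound fuel N a1 a2 w1 w2 acc = true) :
    acc + S * (∑ k ∈ Finset.Ico N (N + fuel),
      max |mollifierError k| |mollifierError (k + 1 : ℕ)| * (1 / (k : ℝ) + (k + 1) / X)) +
      S * |mollifierError (N + fuel : ℕ)| ≤ bound := by
  have hS' : (0 : ℝ) < S := by exact_mod_cast hS
  have hX' : (0 : ℝ) < X := by exact_mod_cast hX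
  induction fuel generalizing N a1 a2 w1 w2 acc with
  | zero =>
    rw [checkError, Nat.ble_eq] at hc
    have h1 := abs_le_max_natAbs h.w_lower h.w_upper
    rw [abs_mul, abs_of_pos hS'] at h1
    have h2 : (acc : ℝ) + (max w1.natAbs w2.natAbs : ℕ) ≤ bound := by exact_mod_cast hc
    simp only [add_zero, Finset.Ico_self, Finset.sum_empty, mul_zero]
    linarith
  | succ fuel ih =>
    have hN0 : (0 : ℝ) < N := by exact_mod_cast hN
    rw [checkError] at hc
    obtain ⟨a1', a2', w1', w2', e, hE⟩ := walk_spec hS (listDivSum mollifier (N + 1)) hN h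
      fun a1' a2' w1' w2' =>
        forceNat (max (max w1.natAbs w2.natAbs) (max w1'.natAbs w2'.natAbs)) fun g =>
        forceNat (N + 1) fun N' =>
        forceNat (acc + g * (X + N * N') / (N * X) + 1) fun acc' =>
        checkError S X bound fuel N' a1' a2' w1' w2' acc'
    have hE := mollifierError_encloses hN rfl rfl hE
    rw [e] at hc
    simp only [forceNat_eq] at hc
    have := ih (N + 1) (by lia) _ hE hc
    rw [show N + 1 + fuel = N + (fuel + 1) by ring] at this
    rw [Finset.sum_eq_sum_Ico_succ_bot (by lia)]
    set g := max (max w1.natAbs w2.natAbs) (max w1'.natAbs w2'.natAbs) with hg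
    have b1 := abs_le_max_natAbs h.w_lower h.w_upper
    have b2 := abs_le_max_natAbs hE.w_lower hE.w_upper
    rw [abs_mul, abs_of_pos hS'] at b1 b2
    have hmax : S * max |mollifierError N| |mollifierError (N + 1 : ℕ)| ≤ g := by
      rw [mul_max_of_nonneg _ _ hS'.le, hg, Nat.cast_max]
      exact max_le_max b1 b2
    have hdiv := (Nat.lt_floor_add_one
      (((g * (X + N * (N + 1)) : ℕ) : ℝ) / ((N * X : ℕ) : ℝ))).le
    rw [Nat.floor_div_eq_div] at hdiv
    have hterm : S * (max |mollifierError N| |mollifierError (N + 1 : ℕ)| *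
        (1 / (N : ℝ) + (N + 1) / X)) ≤ (g * (X + N * (N + 1)) / (N * X) : ℕ) + 1 := by
      refine le_trans ?_ hdiv
      rw [← mul_assoc]
      refine (mul_le_mul_of_nonneg_right hmax (by positivity)).trans (le_of_eq ?_)
      push_cast
      field_simp
    push_cast only [Nat.cast_add, Nat.cast_one] at this hterm ⊢
    rw [mul_add (S : ℝ)]
    linarith

theorem checkSlope_true : checkSlope 100000000 99999871761565 99999898700999 22 1
    100000000000000 100000000000000 0 0 = true := by
  decide +kernel

theorem mollifierSlope_bounds : 99999871761565 ≤ 100000000 * mollifierSlope ∧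
    100000000 * mollifierSlope ≤ 99999898700999 := by
  have h := checkSlope_spec (by norm_num) 22 1 le_rfl (by
    rw [wsum_log_one]
    have : harmSum mollifierFun 1 = 1000000 := by
      simp [harmSum, mollifierFun_apply, show listCoef mollifier 1 = 1000000 by decide]
    rw [this]
    constructor <;> norm_num) checkSlope_true
  rw [wsum_mollifierFun_log (by norm_num)] at h
  exact_mod_cast h

/-- The starting interval is 10^14 minus the two slope bounds, enclosing 10^8 (10^6 - κ); the error
at 1 is exactly 0. -/
theorem checkError_true : checkError 100000000 8192 285000000000 400 1
    101299001 128238435 0 0 0 = true := by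
  decide +kernel

theorem mollifierError_sum_bound : (∑ k ∈ Finset.Ico (1 : ℕ) 401,
      max |mollifierError k| |mollifierError (k + 1 : ℕ)| * (1 / (k : ℝ) + (k + 1) / 8192)) +
      |mollifierError 401| ≤ 2850 := by
  obtain ⟨h1, h2⟩ := mollifierSlope_bounds
  have h := checkError_spec (by norm_num) (by norm_num) 400 1 le_rfl 0 (by
    have e1 : mollifierError (1 : ℕ) = 0 := by rw [mollifierError, wsum_log_one]; simp
    have e2 : harmSum (mollifierFun * (ζ : ArithmeticFunction ℝ)) 1 = 1000000 := by
      rw [harmSum, show Finset.Ioc 0 1 = {1} by decide, Finset.sum_singleton,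
        mollifierFun_mul_zeta (by norm_num), show listDivSum mollifier 1 = 1000000 by decide]
      norm_num
    rw [e1, e2]
    constructor <;> push_cast <;> linarith) checkError_true
  push_cast at h ⊢
  norm_num at h ⊢
  linarith

/-! ### M_1 is close to 1 beyond 8192. -/

theorem abs_moebius_cast_le_one (n : ℕ) : |(μ : ArithmeticFunction ℝ) n| ≤ 1 := by
  rw [ArithmeticFunction.intCoe_apply, ← Int.cast_abs]
  exact_mod_cast ArithmeticFunction.abs_moebius_le_one

/-- The classical argument: the sum of μ(n)⌊N/n⌋ is 1, and replacing floors by N/n costs at most N -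
1, as n = 1 has no fractional part. -/
theorem abs_harmSum_moebius_le_one (N : ℕ) : |harmSum (μ : ArithmeticFunction ℝ) N| ≤ 1 := by
  rcases N.eq_zero_or_pos with rfl | hN
  · simp [harmSum]
  have hN0 : (0 : ℝ) < N := by exact_mod_cast hN
  have h1 : ∑ n ∈ Finset.Ioc 0 N, (μ : ArithmeticFunction ℝ) n * ((N / n : ℕ) : ℝ) = 1 := by
    rw [← ArithmeticFunction.sum_Ioc_mul_zeta_eq_sum, ArithmeticFunction.coe_moebius_mul_coe_zeta,
      Finset.sum_eq_single_of_mem 1 (by simp; lia)]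
    · simp
    · intro b _ hb
      simp [hb]
  have h2 : N * harmSum (μ : ArithmeticFunction ℝ) N = 1 + ∑ n ∈ Finset.Ioc 0 N,
      (μ : ArithmeticFunction ℝ) n * ((N : ℝ) / n - (N / n : ℕ)) := by
    rw [← h1, ← Finset.sum_add_distrib, harmSum, Finset.mul_sum]
    exact Finset.sum_congr rfl fun n _ => by ring
  have h3 : |∑ n ∈ Finset.Ioc 0 N, (μ : ArithmeticFunction ℝ) n * ((N : ℝ) / n - (N / n : ℕ))| ≤
      N - 1 := by
    refine (Finset.abs_sum_le_sum_abs _ _).trans ?_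
    have : ∀ n ∈ Finset.Ioc 0 N, |(μ : ArithmeticFunction ℝ) n * ((N : ℝ) / n - (N / n : ℕ))| ≤
        if n = 1 then 0 else 1 := fun n hn => by
      split_ifs with h
      · subst h; simp
      · rw [abs_mul]
        have b1 : ((N / n : ℕ) : ℝ) ≤ (N : ℝ) / n := Nat.cast_div_le
        have b2 := (Nat.lt_floor_add_one ((N : ℝ) / n)).le
        rw [Nat.floor_div_eq_div] at b2
        have b3 : |(N : ℝ) / n - (N / n : ℕ)| ≤ 1 := by
          rw [abs_of_nonneg (by linarith)]; linarith
        exact mul_le_one₀ (abs_moebius_cast_le_one n) (abs_nonneg _) b3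
    refine (Finset.sum_le_sum this).trans (le_of_eq ?_)
    have e : ∀ n : ℕ, (if n = 1 then (0 : ℝ) else 1) = 1 - if n = 1 then 1 else 0 := fun n => by
      split_ifs <;> norm_num
    simp only [e, Finset.sum_sub_distrib, Finset.sum_ite_eq', Finset.mem_Ioc]
    simp [Nat.one_le_iff_ne_zero.2 hN.ne']
  have h4 : N * |harmSum (μ : ArithmeticFunction ℝ) N| ≤ N * 1 := by
    have e : N * |harmSum (μ : ArithmeticFunction ℝ) N| =
      |N * harmSum (μ : ArithmeticFunction ℝ) N| := by rw [abs_mul, abs_of_pos hN0]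
    rw [e, h2]
    refine (abs_add_le _ _).trans ?_
    rw [abs_one]
    linarith
  exact le_of_mul_le_mul_left h4 hN0

/-- Grouping a sum over `n ≤ N` by the value of `N / n`. -/
theorem sum_Ioc_div_le {K N X : ℕ} (hX : 0 < X) (hN : X ≤ N) (G : ℕ → ℝ) (hG : ∀ k, 0 ≤ G k) :
    ∑ n ∈ Finset.Ioc (N / (K + 1)) N, 1 / (n : ℝ) * G (N / n) ≤
      ∑ k ∈ Finset.Ico 1 (K + 1), G k * (1 / (k : ℝ) + (k + 1) / X) := by
  have hX0 : (0 : ℝ) < X := by exact_mod_cast hX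
  have hN0 : (0 : ℝ) < N := by exact_mod_cast hX.trans_le hN
  have hNX : (X : ℝ) ≤ N := by exact_mod_cast hN
  have hmaps : ∀ n ∈ Finset.Ioc (N / (K + 1)) N, N / n ∈ Finset.Ico 1 (K + 1) := fun n hn => by
    obtain ⟨h1, h2⟩ := Finset.mem_Ioc.1 hn
    have hn0 : 0 < n := by lia
    rw [Finset.mem_Ico, Nat.le_div_iff_mul_le hn0, Nat.div_lt_iff_lt_mul hn0]
    rw [Nat.div_lt_iff_lt_mul (by lia)] at h1
    exact ⟨by lia, by rwa [mul_comm]⟩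
  rw [← Finset.sum_fiberwise_of_maps_to hmaps]
  refine Finset.sum_le_sum fun k hk => ?_
  have hk1 := (Finset.mem_Ico.1 hk).1
  have hk0 : (0 : ℝ) < k := by exact_mod_cast hk1
  have hterm : ∀ n ∈ {n ∈ Finset.Ioc (N / (K + 1)) N | N / n = k},
      1 / (n : ℝ) * G (N / n) ≤ (k + 1) / N * G k := fun n hn => by
    obtain ⟨h1, h2⟩ := Finset.mem_filter.1 hn
    have hn0 : 0 < n := by have := (Finset.mem_Ioc.1 h1).1; lia
    have hn0' : (0 : ℝ) < n := by exact_mod_cast hn0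
    rw [h2]
    refine mul_le_mul_of_nonneg_right ?_ (hG k)
    rw [div_le_div_iff₀ hn0' hN0, one_mul]
    have : N < (k + 1) * n := by rw [← Nat.div_lt_iff_lt_mul hn0]; lia
    exact_mod_cast this.le
  -- The fibre lies in (N/(k+1), N/k]; the + 1 accounts for the floors.
  have hcard : (({n ∈ Finset.Ioc (N / (K + 1)) N | N / n = k}.card : ℕ) : ℝ) ≤
      N / (k * (k + 1)) + 1 := by
    have hsub : {n ∈ Finset.Ioc (N / (K + 1)) N | N / n = k} ⊆
        Finset.Ioc (N / (k + 1)) (N / k) := fun n hn => by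
      obtain ⟨h1, h2⟩ := Finset.mem_filter.1 hn
      have hn0 : 0 < n := by have := (Finset.mem_Ioc.1 h1).1; lia
      rw [Finset.mem_Ioc, Nat.div_lt_iff_lt_mul (by lia), Nat.le_div_iff_mul_le (by lia)]
      constructor
      · rw [mul_comm, ← Nat.div_lt_iff_lt_mul hn0]; lia
      · rw [mul_comm, ← Nat.le_div_iff_mul_le hn0]; lia
    have h1 := Finset.card_le_card hsub
    rw [Nat.card_Ioc] at h1
    have h2 : N / (k + 1) ≤ N / k := Nat.div_le_div_left (by lia) hk1
    have h3 : ((({n ∈ Finset.Ioc (N / (K + 1)) N | N / n = k}.card : ℕ)) : ℝ) ≤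
        (N / k : ℕ) - (N / (k + 1) : ℕ) := by
      rw [← Nat.cast_sub h2]; exact_mod_cast h1
    have h4 : ((N / k : ℕ) : ℝ) ≤ N / k := Nat.cast_div_le
    have h5 := (Nat.lt_floor_add_one ((N : ℝ) / (k + 1 : ℕ))).le
    rw [Nat.floor_div_eq_div] at h5
    push_cast at h5
    have h6 : (N : ℝ) / (k * (k + 1)) = N / k - N / (k + 1) := by field_simp; ring
    linarith
  refine (Finset.sum_le_card_nsmul _ _ _ hterm).trans ?_
  rw [nsmul_eq_mul]
  have hnn : 0 ≤ ((k : ℝ) + 1) / N * G k := mul_nonneg (by positivity) (hG k)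
  calc _ ≤ ((N : ℝ) / (k * (k + 1)) + 1) * (((k : ℝ) + 1) / N * G k) :=
        mul_le_mul_of_nonneg_right hcard hnn
    _ = G k * (1 / (k : ℝ) + (k + 1) / N) := by field_simp
    _ ≤ _ := by
      refine mul_le_mul_of_nonneg_left ?_ (hG k)
      gcongr

/-- Compare the two evaluations of the mean of c = μ * (c * ζ): it is the slope κ, and also κ M_1(N)
plus the sum of the errors. -/
theorem slope_mul_moebius_error {N : ℕ} (hN : 23 ≤ N) :
    mollifierSlope * (1 - wsum (μ : ArithmeticFunction ℝ) Real.log N) =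
      ∑ n ∈ Finset.Ioc 0 N, (μ : ArithmeticFunction ℝ) n / n * mollifierError (N / n) := by
  have h1 : ((μ : ArithmeticFunction ℝ) * (mollifierFun * (ζ : ArithmeticFunction ℝ))) =
      mollifierFun := by
    rw [mul_left_comm, ArithmeticFunction.coe_moebius_mul_coe_zeta, mul_one]
  have h2 := wsum_mul (μ : ArithmeticFunction ℝ)
    (mollifierFun * (ζ : ArithmeticFunction ℝ)) Real.log N
  rw [h1, wsum_mollifierFun_log hN, Nat.floor_natCast] at h2
  simp only [mollifierError, mul_sub]
  rw [Finset.sum_sub_distrib, ← h2, mul_one, wsum, Nat.floor_natCast, Finset.mul_sum]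
  congr 1
  exact Finset.sum_congr rfl fun n _ => by ring

theorem abs_sum_large_quotient_le {N : ℕ} (hN : 8192 ≤ N) :
    |∑ n ∈ Finset.Ioc 0 (N / 401), (μ : ArithmeticFunction ℝ) n / n * mollifierError (N / n)| ≤
      |mollifierError 401| + 2 * 12050000 / 401 ^ 2 := by
  obtain ⟨δ, hδ⟩ := exists_mollifierError_bound
  have hN0 : (0 : ℝ) < N := by exact_mod_cast (by lia : 0 < N)
  set Z := N / 401
  have hZ : (Z : ℝ) ≤ N / 401 := by exact_mod_cast (Nat.cast_div_le : ((N / 401 : ℕ) : ℝ) ≤ _)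
  have hsplit : ∑ n ∈ Finset.Ioc 0 Z, (μ : ArithmeticFunction ℝ) n / n * mollifierError (N / n) =
      δ * harmSum (μ : ArithmeticFunction ℝ) Z +
      ∑ n ∈ Finset.Ioc 0 Z, (μ : ArithmeticFunction ℝ) n / n * (mollifierError (N / n) - δ) := by
    rw [harmSum, Finset.mul_sum, ← Finset.sum_add_distrib]
    exact Finset.sum_congr rfl fun n _ => by ring
  have h1 : |δ * harmSum (μ : ArithmeticFunction ℝ) Z| ≤
      |mollifierError 401| + 12050000 / 401 ^ 2 := by
    rw [abs_mul]
    have a := hδ 401 le_rfl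
    -- The constant δ is never computed; it is controlled by the value at 401.
    have b : |δ| ≤ |mollifierError 401| + |mollifierError 401 - δ| := by
      have := abs_sub (mollifierError 401) (mollifierError 401 - δ)
      simpa using this
    have c := abs_harmSum_moebius_le_one Z
    nlinarith [abs_nonneg δ]
  have h2 : |∑ n ∈ Finset.Ioc 0 Z,
      (μ : ArithmeticFunction ℝ) n / n * (mollifierError (N / n) - δ)| ≤ 12050000 / 401 ^ 2 := by
    refine (Finset.abs_sum_le_sum_abs _ _).trans ?_
    have hterm : ∀ n ∈ Finset.Ioc 0 Z,
        |(μ : ArithmeticFunction ℝ) n / n * (mollifierError (N / n) - δ)| ≤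
        12050000 * (N / 401) / N ^ 2 := fun n hn => by
      have hn0 : (0 : ℝ) < n := by exact_mod_cast (Finset.mem_Ioc.1 hn).1
      have hnZ : (n : ℝ) ≤ N / 401 := le_trans (by exact_mod_cast (Finset.mem_Ioc.1 hn).2) hZ
      have hy : 401 ≤ (N : ℝ) / n := by rw [le_div_iff₀ hn0]; linarith
      have hμ := abs_moebius_cast_le_one n
      rw [abs_mul, abs_div, abs_of_pos hn0]
      calc _ ≤ 1 / (n : ℝ) * (12050000 / (N / n) ^ 2) := by
            gcongr
            exact hδ _ hy
        _ = 12050000 * n / N ^ 2 := by field_simp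
        _ ≤ _ := by gcongr
    refine (Finset.sum_le_card_nsmul _ _ _ hterm).trans ?_
    rw [nsmul_eq_mul, Nat.card_Ioc, Nat.sub_zero]
    calc _ ≤ (N : ℝ) / 401 * (12050000 * (N / 401) / N ^ 2) := by gcongr
      _ = _ := by field_simp
  rw [hsplit]
  refine (abs_add_le _ _).trans ?_
  linarith

theorem abs_one_sub_wsum_moebius_log_le {N : ℕ} (hN : 8192 ≤ N) :
    |1 - wsum (μ : ArithmeticFunction ℝ) Real.log N| ≤ 0.00303 := by
  obtain ⟨hκ1, hκ2⟩ := mollifierSlope_bounds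
  have hN0 : (0 : ℝ) < N := by exact_mod_cast (by lia : 0 < N)
  have h1 := slope_mul_moebius_error (N := N) (by lia)
  have hZ : N / 401 ≤ N := Nat.div_le_self _ _
  rw [← Finset.sum_Ioc_consecutive _ (Nat.zero_le _) hZ] at h1
  have h2 := abs_sum_large_quotient_le hN
  have h3 : |∑ n ∈ Finset.Ioc (N / 401) N,
      (μ : ArithmeticFunction ℝ) n / n * mollifierError (N / n)| ≤
      ∑ k ∈ Finset.Ico (1 : ℕ) 401,
        max |mollifierError k| |mollifierError (k + 1 : ℕ)| * (1 / (k : ℝ) + (k + 1) / 8192) := by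
    have hgroup := sum_Ioc_div_le (K := 400) (by norm_num : 0 < 8192) hN
      (fun k => max |mollifierError k| |mollifierError (k + 1 : ℕ)|)
      fun k => (abs_nonneg _).trans (le_max_left _ _)
    rw [Nat.cast_ofNat] at hgroup
    refine (Finset.abs_sum_le_sum_abs _ _).trans
      ((Finset.sum_le_sum fun n hn => ?_).trans hgroup)
    have hn' := Finset.mem_Ioc.1 hn
    have hn0 : 0 < n := by lia
    have hn0' : (0 : ℝ) < n := by exact_mod_cast hn0
    have hk : 1 ≤ N / n := by rw [Nat.le_div_iff_mul_le hn0]; lia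
    rw [abs_mul, abs_div, abs_of_pos hn0']
    refine mul_le_mul ?_ ?_ (abs_nonneg _) (by positivity)
    · gcongr; exact abs_moebius_cast_le_one n
    · refine abs_mollifierError_le hk Nat.cast_div_le ?_
      have := (Nat.lt_floor_add_one ((N : ℝ) / n)).le
      rwa [Nat.floor_div_eq_div] at this
  have h4 := mollifierError_sum_bound
  -- The total is 2850 + 2 · 12050000/401² < 3000, while 999998 · 0.00303 exceeds 3020.
  have h5 : mollifierSlope * |1 - wsum (μ : ArithmeticFunction ℝ) Real.log N| ≤ 3020 := by
    rw [← abs_of_pos (by linarith : 0 < mollifierSlope), ← abs_mul, h1]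
    refine (abs_add_le _ _).trans ?_
    linarith
  by_contra! hc
  have := mul_le_mul (by linarith : (999998 : ℝ) ≤ mollifierSlope) hc.le (by norm_num)
    (by linarith)
  norm_num at this
  linarith

/-! ### Bounds for M_1 at all arguments. -/

theorem wsum_moebius_log_nat_le {n : ℕ} (hn : 1 ≤ n) :
    wsum (μ : ArithmeticFunction ℝ) Real.log n ≤ 1.00303 := by
  rcases le_total n 8192 with h | h
  · exact (wsum_moebius_log_bounds_of_le hn h).2
  · have := abs_le.1 (abs_one_sub_wsum_moebius_log_le h)
    norm_num at this ⊢
    linarith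

theorem le_wsum_moebius_log_nat {n : ℕ} (hn : 3 ≤ n) :
    0.85 ≤ wsum (μ : ArithmeticFunction ℝ) Real.log n := by
  rcases le_total n 8192 with h | h
  · have := (wsum_moebius_log_bounds_of_le (by lia) h).1
    rwa [if_neg (by lia)] at this
  · have := abs_le.1 (abs_one_sub_wsum_moebius_log_le h)
    norm_num at this ⊢
    linarith

theorem wsum_moebius_log_nat_nonneg {n : ℕ} (hn : 1 ≤ n) :
    0 ≤ wsum (μ : ArithmeticFunction ℝ) Real.log n := by
  rcases le_or_gt 3 n with h | h
  · exact le_trans (by norm_num) (le_wsum_moebius_log_nat h)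
  · have := (wsum_moebius_log_bounds_of_le hn (by lia)).1
    rwa [if_pos (by lia)] at this

theorem wsum_moebius_log_le {X : ℝ} (hX : 1 ≤ X) :
    wsum (μ : ArithmeticFunction ℝ) Real.log X ≤ 1.00303 := by
  obtain ⟨hN, h1, h2⟩ := floor_bounds hX
  rw [wsum_log_eq _ hN h1 h2]
  refine linear_log_le (by exact_mod_cast hN) h1 h2 (wsum_moebius_log_nat_le hN) ?_
  rw [← wsum_log_succ _ hN]
  exact wsum_moebius_log_nat_le (by lia)

theorem wsum_moebius_log_nonneg {X : ℝ} (hX : 1 ≤ X) :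
    0 ≤ wsum (μ : ArithmeticFunction ℝ) Real.log X := by
  obtain ⟨hN, h1, h2⟩ := floor_bounds hX
  rw [wsum_log_eq _ hN h1 h2]
  refine le_of_linear_log (by exact_mod_cast hN) h1 h2 (wsum_moebius_log_nat_nonneg hN) ?_
  rw [← wsum_log_succ _ hN]
  exact wsum_moebius_log_nat_nonneg (by lia)

theorem le_wsum_moebius_log {X : ℝ} (hX : 3 ≤ X) :
    0.85 ≤ wsum (μ : ArithmeticFunction ℝ) Real.log X := by
  obtain ⟨hN, h1, h2⟩ := floor_bounds (by linarith : 1 ≤ X)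
  have h3 : 3 ≤ ⌊X⌋₊ := Nat.le_floor hX
  rw [wsum_log_eq _ hN h1 h2]
  refine le_of_linear_log (by exact_mod_cast hN) h1 h2 (le_wsum_moebius_log_nat h3) ?_
  rw [← wsum_log_succ _ hN]
  exact le_wsum_moebius_log_nat (by lia)

/-! ### The upper bound for M_2. -/

theorem sum_Ioc_natCast (N : ℕ) : ∑ n ∈ Finset.Ioc 0 N, (n : ℝ) = N * (N + 1) / 2 := by
  induction N with
  | zero => simp
  | succ N ih =>
    rw [Finset.sum_Ioc_succ_top (by lia), ih]
    push_cast
    ring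

theorem wsum_moebius_log_sq_le_of_three_le {X : ℝ} (hX : 3 ≤ X) :
    wsum (μ : ArithmeticFunction ℝ) (fun t => Real.log t ^ 2) X ≤ 2 * Real.log X := by
  obtain ⟨d, hd0, hd1, hd⟩ := exists_wsum_zeta_log_bound
  have hX0 : 0 < X := by linarith
  obtain ⟨-, hNX, -⟩ := floor_bounds (by linarith : 1 ≤ X)
  set γ := Real.eulerMascheroniConstant
  set r : ℝ → ℝ := fun u => wsum (ζ : ArithmeticFunction ℝ) Real.log u -
    (Real.log u ^ 2 / 2 + γ * Real.log u + d) with hr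
  have h1 := wsum_mul (μ : ArithmeticFunction ℝ) (ζ : ArithmeticFunction ℝ) Real.log X
  rw [ArithmeticFunction.coe_moebius_mul_coe_zeta, wsum_one _ (by linarith)] at h1
  have h2 : Real.log X = wsum (μ : ArithmeticFunction ℝ) (fun t => Real.log t ^ 2) X / 2 +
      γ * wsum (μ : ArithmeticFunction ℝ) Real.log X +
      d * harmSum (μ : ArithmeticFunction ℝ) ⌊X⌋₊ +
      ∑ n ∈ Finset.Ioc 0 ⌊X⌋₊, (μ : ArithmeticFunction ℝ) n / n * r (X / n) := by
    rw [h1, wsum, wsum, harmSum, Finset.sum_div, Finset.mul_sum, Finset.mul_sum,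
      ← Finset.sum_add_distrib, ← Finset.sum_add_distrib, ← Finset.sum_add_distrib]
    refine Finset.sum_congr rfl fun n _ => ?_
    simp only [hr]
    ring
  -- Since ⌊u⌋ ≥ u/2 for u ≥ 1, each term is at most n/(2X²), which sums to at most (1 + 1/X)/4; X ≥
  -- 3 gives 1/3.
  have h3 : |∑ n ∈ Finset.Ioc 0 ⌊X⌋₊, (μ : ArithmeticFunction ℝ) n / n * r (X / n)| ≤ 1 / 3 := by
    have hterm : ∀ n ∈ Finset.Ioc 0 ⌊X⌋₊, |(μ : ArithmeticFunction ℝ) n / n * r (X / n)| ≤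
        n * (1 / (2 * X ^ 2)) := fun n hn => by
      have hn0 : (0 : ℝ) < n := by exact_mod_cast (Finset.mem_Ioc.1 hn).1
      have hnX : (n : ℝ) ≤ X := le_trans (by exact_mod_cast (Finset.mem_Ioc.1 hn).2) hNX
      have hu : 1 ≤ X / n := by rwa [le_div_iff₀ hn0, one_mul]
      obtain ⟨hf1, -, hf2⟩ := floor_bounds hu
      have hf : X / n / 2 ≤ (⌊X / n⌋₊ : ℝ) := by
        have : (1 : ℝ) ≤ ⌊X / n⌋₊ := by exact_mod_cast hf1
        linarith
      have hpos : 0 < X / n / 2 := by positivity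
      rw [abs_mul, abs_div, abs_of_pos hn0]
      calc _ ≤ 1 / (n : ℝ) * (1 / (8 * (⌊X / n⌋₊ : ℝ) ^ 2)) := by
            gcongr
            · exact abs_moebius_cast_le_one n
            · exact hd _ hu
        _ ≤ 1 / (n : ℝ) * (1 / (8 * (X / n / 2) ^ 2)) := by gcongr
        _ = _ := by field_simp; norm_num
    refine (Finset.abs_sum_le_sum_abs _ _).trans ((Finset.sum_le_sum hterm).trans ?_)
    rw [← Finset.sum_mul, sum_Ioc_natCast]
    calc _ ≤ X * (X + 1) / 2 * (1 / (2 * X ^ 2)) := by gcongr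
      _ = (1 + 1 / X) / 4 := by field_simp; norm_num
      _ ≤ (1 + 1 / 3) / 4 := by gcongr
      _ = 1 / 3 := by norm_num
  have h4 := abs_le.1 h3
  have h5 := abs_le.1 (abs_harmSum_moebius_le_one ⌊X⌋₊)
  have h6 := le_wsum_moebius_log hX
  have h7 : 1 / 2 < γ := Real.one_half_lt_eulerMascheroniConstant
  have h8 : 1 / 2 * 0.85 ≤ γ * wsum (μ : ArithmeticFunction ℝ) Real.log X :=
    mul_le_mul h7.le h6 (by norm_num) (by linarith)
  have h9 : -(1 / 12) ≤ d * harmSum (μ : ArithmeticFunction ℝ) ⌊X⌋₊ := by nlinarith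
  norm_num at h8
  -- The margin is thin: 0.425 - 1/12 - 1/3 > 0.
  linarith

theorem wsum_moebius_log_sq_le {X : ℝ} (hX : 1 ≤ X) :
    wsum (μ : ArithmeticFunction ℝ) (fun t => Real.log t ^ 2) X ≤ 2 * Real.log X := by
  rcases le_or_gt 3 X with h | h
  · exact wsum_moebius_log_sq_le_of_three_le h
  have hl0 := Real.log_nonneg hX
  have hl2 : Real.log X ≤ 2 := by linarith [Real.log_le_sub_one_of_pos (by linarith : 0 < X)]
  have hsq : Real.log X ^ 2 ≤ 2 * Real.log X := by nlinarith
  rcases lt_or_ge X 2 with h2 | h2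
  · have hf : ⌊X⌋₊ = 1 := by rw [Nat.floor_eq_iff (by linarith)]; norm_num; exact ⟨hX, h2⟩
    rw [wsum, hf]
    simpa using hsq
  · have hf : ⌊X⌋₊ = 2 := by rw [Nat.floor_eq_iff (by linarith)]; norm_num; exact ⟨h2, h⟩
    have hm : ((μ 2 : ℤ) : ℝ) = -1 := by
      rw [ArithmeticFunction.moebius_apply_prime Nat.prime_two]; norm_num
    rw [wsum, hf, Finset.sum_Ioc_succ_top (by norm_num), Finset.sum_Ioc_succ_top (by norm_num)]
    simp only [Finset.Ioc_self, Finset.sum_empty, ArithmeticFunction.intCoe_apply]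
    norm_num [hm]
    nlinarith [sq_nonneg (Real.log (X / 2))]

/-! ### Higher powers by integration in log X. -/

/-- At the kink the function is O(|y|^(k+1)) with k + 1 ≥ 2, so its derivative vanishes there. -/
theorem hasDerivAt_max_zero_pow {k : ℕ} (hk : 1 ≤ k) (x : ℝ) :
    HasDerivAt (fun y : ℝ => max y 0 ^ (k + 1)) ((k + 1 : ℕ) * max x 0 ^ k) x := by
  rcases lt_trichotomy x 0 with h | rfl | h
  · rw [max_eq_right h.le, zero_pow (by lia), mul_zero]
    refine (hasDerivAt_const x (0 : ℝ)).congr_of_eventuallyEq ?_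
    filter_upwards [gt_mem_nhds h] with y hy
    rw [max_eq_right hy.le, zero_pow (by lia)]
  · rw [max_self, zero_pow (by lia), mul_zero]
    have : HasFDerivAt (fun y : ℝ => max y 0 ^ (k + 1)) (0 : ℝ →L[ℝ] ℝ) 0 := by
      refine Asymptotics.IsBigO.hasFDerivAt (n := k + 1) ?_ (by lia)
      refine Asymptotics.isBigO_of_le _ fun y => ?_
      rw [sub_zero, norm_pow, norm_pow, norm_norm]
      refine pow_le_pow_left₀ (norm_nonneg _) ?_ _
      rw [Real.norm_eq_abs, Real.norm_eq_abs, abs_of_nonneg (le_max_right _ _)]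
      exact max_le (le_abs_self y) (abs_nonneg y)
    simpa using this.hasDerivAt
  · rw [max_eq_left h.le]
    refine (hasDerivAt_pow (k + 1) x).congr_of_eventuallyEq ?_
    filter_upwards [lt_mem_nhds h] with y hy
    rw [max_eq_left hy.le]

/-- `∑_{n ≤ N} f n / n * max (v - log n) 0 ^ k`, a smooth version of
`wsum f (log ^ k) (exp v)`. -/
noncomputable def logPowSum (f : ArithmeticFunction ℝ) (N k : ℕ) (v : ℝ) : ℝ :=
  ∑ n ∈ Finset.Ioc 0 N, f n / n * max (v - Real.log n) 0 ^ k

theorem hasDerivAt_logPowSum (f : ArithmeticFunction ℝ) (N : ℕ) {k : ℕ} (hk : 1 ≤ k) (v : ℝ) :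
    HasDerivAt (logPowSum f N (k + 1)) ((k + 1 : ℕ) * logPowSum f N k v) v := by
  unfold logPowSum
  rw [Finset.mul_sum]
  refine HasDerivAt.fun_sum fun n _ => ?_
  have := ((hasDerivAt_max_zero_pow hk (v - Real.log n)).comp_sub_const v (Real.log n)).const_mul
    (f n / n)
  refine this.congr_deriv ?_
  ring

/-- The positive part discards n > e^v, so the range of summation can stay fixed while v varies. -/
theorem logPowSum_eq (f : ArithmeticFunction ℝ) {N k : ℕ} (hk : 1 ≤ k) {v : ℝ}
    (hN : ⌊Real.exp v⌋₊ ≤ N) :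
    logPowSum f N k v = wsum f (fun t => Real.log t ^ k) (Real.exp v) := by
  rw [logPowSum, wsum, ← Finset.sum_subset (Finset.Ioc_subset_Ioc_right hN)]
  · refine Finset.sum_congr rfl fun n hn => ?_
    obtain ⟨h1, h2⟩ := Finset.mem_Ioc.1 hn
    have hn0 : (0 : ℝ) < n := by exact_mod_cast h1
    have hle : (n : ℝ) ≤ Real.exp v := (Nat.le_floor_iff (Real.exp_pos v).le).1 h2
    have hlog : Real.log n ≤ v := (Real.log_le_iff_le_exp hn0).2 hle
    rw [Real.log_div (Real.exp_ne_zero v) hn0.ne', Real.log_exp, max_eq_left (by linarith)]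
  · intro n hn hn'
    have h1 := (Finset.mem_Ioc.1 hn).1
    have hn0 : (0 : ℝ) < n := by exact_mod_cast h1
    have h2 : ⌊Real.exp v⌋₊ < n := by
      by_contra! h; exact hn' (Finset.mem_Ioc.2 ⟨h1, h⟩)
    have hlog : v ≤ Real.log n :=
      (Real.le_log_iff_exp_le hn0).2 (Nat.lt_of_floor_lt h2).le
    rw [max_eq_right (by linarith), zero_pow (by lia), mul_zero]

theorem logPowSum_zero (f : ArithmeticFunction ℝ) (N : ℕ) {k : ℕ} (hk : 1 ≤ k) :
    logPowSum f N k 0 = 0 := by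
  refine Finset.sum_eq_zero fun n hn => ?_
  have h1 : (1 : ℝ) ≤ n := by exact_mod_cast (Finset.mem_Ioc.1 hn).1
  rw [max_eq_right (by linarith [Real.log_nonneg h1]), zero_pow (by lia), mul_zero]

theorem wsum_log_pow_succ_nonneg {f : ArithmeticFunction ℝ} {k : ℕ} (hk : 1 ≤ k)
    (h : ∀ X : ℝ, 1 ≤ X → 0 ≤ wsum f (fun t => Real.log t ^ k) X) {X : ℝ} (hX : 1 ≤ X) :
    0 ≤ wsum f (fun t => Real.log t ^ (k + 1)) X := by
  have hX0 : 0 < X := by linarith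
  have hl := Real.log_nonneg hX
  have hmono : MonotoneOn (logPowSum f ⌊X⌋₊ (k + 1)) (Set.Icc 0 (Real.log X)) := by
    refine monotoneOn_of_hasDerivWithinAt_nonneg (convex_Icc _ _)
      (fun v _ => (hasDerivAt_logPowSum f _ hk v).continuousAt.continuousWithinAt)
      (fun v _ => (hasDerivAt_logPowSum f _ hk v).hasDerivWithinAt) fun v hv => ?_
    rw [interior_Icc] at hv
    have hfl : ⌊Real.exp v⌋₊ ≤ ⌊X⌋₊ :=
      Nat.floor_le_floor ((Real.le_log_iff_exp_le hX0).1 hv.2.le)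
    rw [logPowSum_eq f hk hfl]
    exact mul_nonneg (Nat.cast_nonneg _) (h _ (Real.one_le_exp hv.1.le))
  have := hmono ⟨le_rfl, hl⟩ ⟨hl, le_rfl⟩ hl
  rwa [logPowSum_zero f _ (by lia), logPowSum_eq f (by lia) (by rw [Real.exp_log hX0]),
    Real.exp_log hX0] at this

theorem wsum_log_pow_succ_le {f : ArithmeticFunction ℝ} {k : ℕ} (hk : 1 ≤ k)
    (h : ∀ X : ℝ, 1 ≤ X → wsum f (fun t => Real.log t ^ k) X ≤ k * Real.log X ^ (k - 1))
    {X : ℝ} (hX : 1 ≤ X) :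
    wsum f (fun t => Real.log t ^ (k + 1)) X ≤ (k + 1 : ℕ) * Real.log X ^ k := by
  have hX0 : 0 < X := by linarith
  have hl := Real.log_nonneg hX
  have hder : ∀ v : ℝ, HasDerivAt
      (fun v => (k + 1 : ℕ) * v ^ k - logPowSum f ⌊X⌋₊ (k + 1) v)
      ((k + 1 : ℕ) * (k * v ^ (k - 1)) - (k + 1 : ℕ) * logPowSum f ⌊X⌋₊ k v) v := fun v =>
    ((hasDerivAt_pow k v).const_mul _).sub (hasDerivAt_logPowSum f _ hk v)
  have hmono : MonotoneOn (fun v => (k + 1 : ℕ) * v ^ k - logPowSum f ⌊X⌋₊ (k + 1) v)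
      (Set.Icc 0 (Real.log X)) := by
    refine monotoneOn_of_hasDerivWithinAt_nonneg (convex_Icc _ _)
      (fun v _ => (hder v).continuousAt.continuousWithinAt)
      (fun v _ => (hder v).hasDerivWithinAt) fun v hv => ?_
    rw [interior_Icc] at hv
    have hfl : ⌊Real.exp v⌋₊ ≤ ⌊X⌋₊ :=
      Nat.floor_le_floor ((Real.le_log_iff_exp_le hX0).1 hv.2.le)
    rw [logPowSum_eq f hk hfl, ← mul_sub]
    have := h _ (Real.one_le_exp hv.1.le)
    rw [Real.log_exp] at this
    exact mul_nonneg (Nat.cast_nonneg _) (by linarith)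
  have := hmono ⟨le_rfl, hl⟩ ⟨hl, le_rfl⟩ hl
  simp only at this
  rw [logPowSum_zero f _ (by lia), logPowSum_eq f (by lia) (by rw [Real.exp_log hX0]),
    Real.exp_log hX0, zero_pow (by lia)] at this
  linarith

theorem wsum_moebius_log_pow_nonneg {k : ℕ} (hk : 1 ≤ k) {X : ℝ} (hX : 1 ≤ X) :
    0 ≤ wsum (μ : ArithmeticFunction ℝ) (fun t => Real.log t ^ k) X := by
  induction k, hk using Nat.le_induction generalizing X with
  | base => simpa only [pow_one] using wsum_moebius_log_nonneg hX
  | succ k hk ih => exact wsum_log_pow_succ_nonneg hk (fun X hX => ih hX) hX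

theorem wsum_moebius_log_pow_le {k : ℕ} (hk : 2 ≤ k) {X : ℝ} (hX : 1 ≤ X) :
    wsum (μ : ArithmeticFunction ℝ) (fun t => Real.log t ^ k) X ≤ k * Real.log X ^ (k - 1) := by
  induction k, hk using Nat.le_induction generalizing X with
  | base => simpa using wsum_moebius_log_sq_le hX
  | succ k hk ih => exact wsum_log_pow_succ_le (by lia) (fun X hX => ih hX) hX

/-! ### The coprimality condition, one prime at a time. -/

/-- The Möbius function restricted to integers with no divisor in `P`. -/
noncomputable def moebiusAvoiding (P : Finset ℕ) : ArithmeticFunction ℝ :=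
  ⟨fun n => if ∀ p ∈ P, ¬ p ∣ n then (μ n : ℝ) else 0, by simp⟩

theorem moebiusAvoiding_apply (P : Finset ℕ) (n : ℕ) :
    moebiusAvoiding P n = if ∀ p ∈ P, ¬ p ∣ n then (μ n : ℝ) else 0 := rfl

theorem moebiusAvoiding_empty : moebiusAvoiding ∅ = (μ : ArithmeticFunction ℝ) := by
  ext n
  simp [moebiusAvoiding_apply, ArithmeticFunction.intCoe_apply]

/-- The arithmetic function with value `1` at `p` and `0` elsewhere. -/
noncomputable def pointMass {p : ℕ} (hp : p ≠ 0) : ArithmeticFunction ℝ :=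
  ⟨fun n => if n = p then 1 else 0, by simp [hp.symm]⟩

theorem pointMass_mul_apply {p : ℕ} (hp : p ≠ 0) (g : ArithmeticFunction ℝ) (n : ℕ) :
    (pointMass hp * g) n = if p ∣ n then g (n / p) else 0 := by
  rcases eq_or_ne n 0 with rfl | hn
  · simp
  · rw [ArithmeticFunction.mul_apply,
      Nat.sum_divisorsAntidiagonal (fun i j => pointMass hp i * g j)]
    simp [pointMass, hn]

/-- In Dirichlet series, removing p divides by the Euler factor 1 - p^(-s); the identity is written
multiplicatively to avoid an inverse. -/
theorem moebiusAvoiding_insert {P : Finset ℕ} (hP : ∀ q ∈ P, q.Prime) {p : ℕ} (hp : p.Prime)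
    (hpP : p ∉ P) :
    moebiusAvoiding P = (1 - pointMass hp.ne_zero) * moebiusAvoiding (insert p P) := by
  ext n
  rw [sub_mul, one_mul, sub_eq_add_neg, ArithmeticFunction.add_apply,
    ArithmeticFunction.neg_apply, pointMass_mul_apply]
  simp only [moebiusAvoiding_apply, Finset.forall_mem_insert]
  by_cases h : p ∣ n
  · obtain ⟨m, rfl⟩ := h
    have hiff : (∀ q ∈ P, ¬ q ∣ p * m) ↔ ∀ q ∈ P, ¬ q ∣ m := by
      refine forall₂_congr fun q hq => not_congr ⟨fun h => ?_, fun h => h.mul_left p⟩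
      refine ((hP q hq).dvd_mul.1 h).resolve_left fun h => hpP ?_
      rwa [← (Nat.prime_dvd_prime_iff_eq (hP q hq) hp).1 h]
    simp only [dvd_mul_right, not_true_eq_false, false_and, if_false, if_true, zero_add,
      Nat.mul_div_cancel_left m hp.pos, hiff]
    by_cases h2 : p ∣ m
    · obtain ⟨t, rfl⟩ := h2
      have : μ (p * (p * t)) = 0 := ArithmeticFunction.moebius_eq_zero_of_not_squarefree
        fun h => hp.not_isUnit (h p ⟨t, by ring⟩)
      simp [this]
    · have : μ (p * m) = -μ m := by
        rw [ArithmeticFunction.isMultiplicative_moebius.map_mul_of_coprime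
          ((Nat.Prime.coprime_iff_not_dvd hp).2 h2), ArithmeticFunction.moebius_apply_prime hp]
        ring
      simp only [this, h2, not_false_eq_true, true_and]
      split_ifs <;> simp
  · simp [h]

theorem wsum_moebiusAvoiding_insert {P : Finset ℕ} (hP : ∀ q ∈ P, q.Prime) {p : ℕ}
    (hp : p.Prime) (hpP : p ∉ P) (w : ℝ → ℝ) {X : ℝ} (hX : 1 ≤ X) :
    wsum (moebiusAvoiding (insert p P)) w X =
      wsum (moebiusAvoiding P) w X + 1 / p * wsum (moebiusAvoiding (insert p P)) w (X / p) := by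
  have hN : 1 ≤ ⌊X⌋₊ := (floor_bounds hX).1
  have hp0 : (0 : ℝ) < p := by exact_mod_cast hp.pos
  have hterm : ∀ d : ℕ, (1 - pointMass hp.ne_zero : ArithmeticFunction ℝ) d =
      (if d = 1 then 1 else 0) - if d = p then 1 else 0 := fun d => by
    rw [sub_eq_add_neg, ArithmeticFunction.add_apply, ArithmeticFunction.neg_apply,
      ArithmeticFunction.one_apply, ← sub_eq_add_neg]
    rfl
  rw [moebiusAvoiding_insert hP hp hpP, wsum_mul]
  simp only [hterm, sub_div, sub_mul, Finset.sum_sub_distrib, ite_div, zero_div, ite_mul, zero_mul,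
    Finset.sum_ite_eq', Finset.mem_Ioc]
  have h1 : (0 < 1 ∧ 1 ≤ ⌊X⌋₊) := ⟨one_pos, hN⟩
  rw [if_pos h1]
  split_ifs with h2
  · push_cast
    rw [div_one, div_one]
    ring
  · have : X / p < 1 := by
      rw [div_lt_one hp0]
      by_contra! h
      exact h2 ⟨hp.pos, Nat.le_floor h⟩
    rw [wsum_eq_zero _ _ this]
    push_cast
    rw [div_one, div_one]
    ring

/-- Bounds for `wsum μ w` are inherited, up to an Euler factor, when the prime `p` is excluded. -/
theorem wsum_moebiusAvoiding_insert_bounds {P : Finset ℕ} (hP : ∀ q ∈ P, q.Prime) {p : ℕ}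
    (hp : p.Prime) (hpP : p ∉ P) (w : ℝ → ℝ) {B : ℝ → ℝ} (hB : MonotoneOn B (Set.Ici 1))
    (hB0 : 0 ≤ B 1)
    (h : ∀ X : ℝ, 1 ≤ X → 0 ≤ wsum (moebiusAvoiding P) w X ∧ wsum (moebiusAvoiding P) w X ≤ B X)
    {X : ℝ} (hX : 1 ≤ X) :
    0 ≤ wsum (moebiusAvoiding (insert p P)) w X ∧
    wsum (moebiusAvoiding (insert p P)) w X ≤ (1 - (p : ℝ)⁻¹)⁻¹ * B X := by
  have hp2 : (2 : ℝ) ≤ p := by exact_mod_cast hp.two_le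
  have hp1 : (p : ℝ)⁻¹ ≤ 1 / 2 := by rw [inv_eq_one_div]; gcongr
  have hp0 : (0 : ℝ) < (p : ℝ)⁻¹ := by positivity
  set E := (1 - (p : ℝ)⁻¹)⁻¹ with hE
  have hE0 : 0 ≤ E := inv_nonneg.2 (by linarith)
  have hE1 : 1 + 1 / (p : ℝ) * E = E := by
    have : (1 - (p : ℝ)⁻¹) * E = 1 := mul_inv_cancel₀ (by linarith)
    rw [one_div]
    linarith
  have hBnn : ∀ Y : ℝ, 1 ≤ Y → 0 ≤ B Y := fun Y hY => hB0.trans (hB (by simp) hY hY)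
  -- Induction on the dyadic scale of Y: p ≥ 2 moves Y/p down one scale, and 1 + E/p = E closes the
  -- upper bound.
  have main : ∀ (n : ℕ) (Y : ℝ), 1 ≤ Y → Y ≤ 2 ^ n →
      0 ≤ wsum (moebiusAvoiding (insert p P)) w Y ∧
      wsum (moebiusAvoiding (insert p P)) w Y ≤ E * B Y := by
    have step : ∀ Y : ℝ, 1 ≤ Y → (0 ≤ wsum (moebiusAvoiding (insert p P)) w (Y / p) ∧
        wsum (moebiusAvoiding (insert p P)) w (Y / p) ≤ E * B Y) →
        0 ≤ wsum (moebiusAvoiding (insert p P)) w Y ∧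
        wsum (moebiusAvoiding (insert p P)) w Y ≤ E * B Y := fun Y hY hYp => by
      obtain ⟨a1, a2⟩ := h Y hY
      rw [wsum_moebiusAvoiding_insert hP hp hpP w hY]
      have hpp : 0 ≤ 1 / (p : ℝ) := by positivity
      refine ⟨add_nonneg a1 (mul_nonneg hpp hYp.1), ?_⟩
      calc _ ≤ B Y + 1 / (p : ℝ) * (E * B Y) :=
            add_le_add a2 (mul_le_mul_of_nonneg_left hYp.2 hpp)
        _ = (1 + 1 / (p : ℝ) * E) * B Y := by ring
        _ = _ := by rw [hE1]
    intro n
    induction n with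
    | zero =>
      intro Y hY hY2
      refine step Y hY ?_
      rw [wsum_eq_zero _ _ (by rw [div_lt_one (by linarith)]; norm_num at hY2; linarith)]
      exact ⟨le_rfl, mul_nonneg hE0 (hBnn Y hY)⟩
    | succ n ih =>
      intro Y hY hY2
      refine step Y hY ?_
      rcases lt_or_ge (Y / p) 1 with hlt | hge
      · rw [wsum_eq_zero _ _ hlt]
        exact ⟨le_rfl, mul_nonneg hE0 (hBnn Y hY)⟩
      · have hle : Y / p ≤ 2 ^ n := by
          rw [div_le_iff₀ (by linarith)]
          rw [pow_succ] at hY2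
          have : (0 : ℝ) < 2 ^ n := by positivity
          nlinarith
        obtain ⟨b1, b2⟩ := ih _ hge hle
        refine ⟨b1, b2.trans (mul_le_mul_of_nonneg_left (hB hge hY ?_) hE0)⟩
        exact div_le_self (by linarith) (by linarith)
  obtain ⟨n, hn⟩ := pow_unbounded_of_one_lt X (by norm_num : (1 : ℝ) < 2)
  exact main n X hX hn.le

theorem wsum_moebiusAvoiding_bounds {P : Finset ℕ} (hP : ∀ q ∈ P, q.Prime) (w : ℝ → ℝ)
    {B : ℝ → ℝ} (hB : MonotoneOn B (Set.Ici 1)) (hB0 : 0 ≤ B 1)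
    (h : ∀ X : ℝ, 1 ≤ X → 0 ≤ wsum (μ : ArithmeticFunction ℝ) w X ∧
      wsum (μ : ArithmeticFunction ℝ) w X ≤ B X)
    {X : ℝ} (hX : 1 ≤ X) :
    0 ≤ wsum (moebiusAvoiding P) w X ∧
    wsum (moebiusAvoiding P) w X ≤ (∏ p ∈ P, (1 - (p : ℝ)⁻¹)⁻¹) * B X := by
  induction P using Finset.induction_on generalizing X with
  | empty => simpa [moebiusAvoiding_empty] using h X hX
  | insert p P hpP ih =>
    have hP' : ∀ q ∈ P, q.Prime := fun q hq => hP q (Finset.mem_insert_of_mem hq)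
    have hC : 0 ≤ ∏ p ∈ P, (1 - (p : ℝ)⁻¹)⁻¹ := Finset.prod_nonneg fun q hq => by
      have : (1 : ℝ) ≤ q := by exact_mod_cast (hP' q hq).one_lt.le
      exact inv_nonneg.2 (sub_nonneg.2 (inv_le_one_of_one_le₀ this))
    rw [Finset.prod_insert hpP, mul_assoc]
    exact wsum_moebiusAvoiding_insert_bounds hP' (hP p (Finset.mem_insert_self p P)) hpP w
      (B := fun X => (∏ p ∈ P, (1 - (p : ℝ)⁻¹)⁻¹) * B X)
      (fun a ha b hb hab => mul_le_mul_of_nonneg_left (hB ha hb hab) hC)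
      (mul_nonneg hC hB0) (fun Y hY => ih hP' hY) hX

theorem prod_primeFactors_inv {q : ℕ} (hq : q ≠ 0) :
    ∏ p ∈ q.primeFactors, (1 - (p : ℝ)⁻¹)⁻¹ = (q : ℝ) / Nat.totient q := by
  have h : ((Nat.totient q : ℕ) : ℝ) = q * ∏ p ∈ q.primeFactors, (1 - (p : ℝ)⁻¹) := by
    have := congrArg (Rat.cast : ℚ → ℝ) (Nat.totient_eq_mul_prod_factors q)
    push_cast at this
    exact this
  have hq0 : (q : ℝ) ≠ 0 := by exact_mod_cast hq
  rw [h, Finset.prod_inv_distrib, div_mul_eq_div_div, div_self hq0, one_div]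

theorem coprime_iff_forall_primeFactors {n q : ℕ} (hq : q ≠ 0) :
    Nat.Coprime n q ↔ ∀ p ∈ q.primeFactors, ¬ p ∣ n := by
  constructor
  · intro h p hp hpn
    obtain ⟨h1, h2, -⟩ := Nat.mem_primeFactors.1 hp
    exact Nat.not_coprime_of_dvd_of_dvd h1.one_lt hpn h2 h
  · intro h
    refine Nat.coprime_of_dvd fun p hp hpn hpq => ?_
    exact h p (Nat.mem_primeFactors.2 ⟨hp, hpq, hq⟩) hpn

/-! ### The exponent σ and the final bounds. -/

theorem hasSum_exp_mul_linear (k t : ℝ) :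
    HasSum (fun j : ℕ => t ^ j / (j.factorial : ℝ) * (k + j)) ((k + t) * Real.exp t) := by
  have h := NormedSpace.expSeries_div_hasSum_exp t
  rw [← Real.exp_eq_exp_ℝ] at h
  have h2 : HasSum (fun j : ℕ => t ^ j / (j.factorial : ℝ) * j) (t * Real.exp t) := by
    rw [← hasSum_nat_add_iff' 1]
    simp only [Finset.range_one, Finset.sum_singleton, Nat.cast_zero, mul_zero, sub_zero]
    refine (h.mul_left t).congr_fun fun j => ?_
    rw [Nat.factorial_succ]
    have : (j.factorial : ℝ) ≠ 0 := by positivity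
    push_cast
    field_simp
    ring
  have := (h.mul_left k).add h2
  rw [← add_mul] at this
  refine this.congr_fun fun j => ?_
  ring

theorem hasSum_wsum_log_pow (f : ArithmeticFunction ℝ) (k : ℕ) (ε X : ℝ) :
    HasSum (fun j : ℕ => ε ^ j / (j.factorial : ℝ) * wsum f (fun t => Real.log t ^ (k + j)) X)
      (wsum f (fun t => Real.log t ^ k * Real.exp (ε * Real.log t)) X) := by
  simp only [wsum, Finset.mul_sum]
  refine hasSum_sum fun n _ => ?_
  have h := NormedSpace.expSeries_div_hasSum_exp (ε * Real.log (X / n))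
  rw [← Real.exp_eq_exp_ℝ] at h
  have := h.mul_left (f n / n * Real.log (X / n) ^ k)
  rw [mul_assoc] at this
  refine this.congr_fun fun j => ?_
  rw [mul_pow, pow_add]
  ring

theorem wsum_log_pow_exp_bounds {f : ArithmeticFunction ℝ} {k : ℕ} (hk : 1 ≤ k) {ε X C : ℝ}
    (hε : 0 ≤ ε) (h : ∀ m, k ≤ m → 0 ≤ wsum f (fun t => Real.log t ^ m) X ∧
      wsum f (fun t => Real.log t ^ m) X ≤ C * (m * Real.log X ^ (m - 1))) :
    0 ≤ wsum f (fun t => Real.log t ^ k * Real.exp (ε * Real.log t)) X ∧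
    wsum f (fun t => Real.log t ^ k * Real.exp (ε * Real.log t)) X ≤
      C * (k + ε * Real.log X) * Real.log X ^ (k - 1) * Real.exp (ε * Real.log X) := by
  have hs := hasSum_wsum_log_pow f k ε X
  constructor
  · exact hs.nonneg fun j => mul_nonneg (by positivity) (h _ (by lia)).1
  · have hu := (hasSum_exp_mul_linear k (ε * Real.log X)).mul_left (C * Real.log X ^ (k - 1))
    refine (hasSum_le (fun j => ?_) hs hu).trans (le_of_eq (by ring))
    refine (mul_le_mul_of_nonneg_left (h (k + j) (by lia)).2 (by positivity)).trans (le_of_eq ?_)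
    rw [show k + j - 1 = (k - 1) + j by lia, pow_add, mul_pow]
    push_cast
    ring

theorem sum_coprime_moebius_eq {q : ℕ} (hq : q ≠ 0) (k : ℕ) {σ X : ℝ} (hX : 1 ≤ X) :
    ∑ n ∈ (Finset.Icc 1 ⌊X⌋₊).filter (fun n => Nat.Coprime n q),
      (ArithmeticFunction.moebius n : ℝ) / (n : ℝ) ^ σ * Real.log (X / (n : ℝ)) ^ k =
    Real.exp (-((σ - 1) * Real.log X)) * wsum (moebiusAvoiding q.primeFactors)
      (fun t => Real.log t ^ k * Real.exp ((σ - 1) * Real.log t)) X := by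
  rw [wsum, Finset.mul_sum, Finset.sum_filter]
  refine Finset.sum_congr (by ext; simp [Nat.lt_iff_add_one_le]) fun n hn => ?_
  have hn0 : (0 : ℝ) < n := by exact_mod_cast (Finset.mem_Icc.1 hn).1
  simp only [moebiusAvoiding_apply, coprime_iff_forall_primeFactors hq]
  split_ifs
  · have e : (n : ℝ) ^ σ = n * Real.exp ((σ - 1) * Real.log n) := by
      rw [Real.rpow_def_of_pos hn0]
      nth_rewrite 2 [← Real.exp_log hn0]
      rw [← Real.exp_add]
      ring_nf
    have e2 : Real.exp (-((σ - 1) * Real.log X)) * Real.exp ((σ - 1) * Real.log (X / n)) =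
        (Real.exp ((σ - 1) * Real.log n))⁻¹ := by
      rw [← Real.exp_add, ← Real.exp_neg, Real.log_div (by linarith) hn0.ne']
      ring_nf
    rw [e, div_mul_eq_div_div, div_eq_mul_inv _ (Real.exp _), ← e2]
    ring
  · simp

theorem monotoneOn_const_mul_log_pow {a : ℝ} (ha : 0 ≤ a) (j : ℕ) :
    MonotoneOn (fun X => a * Real.log X ^ j) (Set.Ici 1) := fun x hx y _ hxy => by
  have hx1 : 1 ≤ x := hx
  have h0 := Real.log_nonneg hx1
  have h1 : Real.log x ≤ Real.log y := Real.log_le_log (by linarith) hxy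
  exact mul_le_mul_of_nonneg_left (pow_le_pow_left₀ h0 h1 j) ha

theorem sum_coprime_moebius_bounds {q k : ℕ} (hq : q ≠ 0) (hk : 1 ≤ k) {σ X c : ℝ} (hσ : 1 ≤ σ)
    (hX : 1 ≤ X) (hc : 0 ≤ c)
    (h : ∀ m, k ≤ m → ∀ Y : ℝ, 1 ≤ Y →
      wsum (μ : ArithmeticFunction ℝ) (fun t => Real.log t ^ m) Y ≤ c * m * Real.log Y ^ (m - 1)) :
    0 ≤ ∑ n ∈ (Finset.Icc 1 ⌊X⌋₊).filter (fun n => Nat.Coprime n q),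
      (ArithmeticFunction.moebius n : ℝ) / (n : ℝ) ^ σ * Real.log (X / (n : ℝ)) ^ k ∧
    ∑ n ∈ (Finset.Icc 1 ⌊X⌋₊).filter (fun n => Nat.Coprime n q),
      (ArithmeticFunction.moebius n : ℝ) / (n : ℝ) ^ σ * Real.log (X / (n : ℝ)) ^ k ≤
      c * ((q : ℝ) / (Nat.totient q : ℝ)) * ((k : ℝ) + (σ - 1) * Real.log X) *
        Real.log X ^ (k - 1) := by
  have hb : ∀ m, k ≤ m → 0 ≤ wsum (moebiusAvoiding q.primeFactors) (fun t => Real.log t ^ m) X ∧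
      wsum (moebiusAvoiding q.primeFactors) (fun t => Real.log t ^ m) X ≤
        c * ((q : ℝ) / (Nat.totient q : ℝ)) * (m * Real.log X ^ (m - 1)) := fun m hm => by
    obtain ⟨h1, h2⟩ := wsum_moebiusAvoiding_bounds (P := q.primeFactors)
      (fun p hp => Nat.prime_of_mem_primeFactors hp) (fun t => Real.log t ^ m)
      (monotoneOn_const_mul_log_pow (a := c * m) (by positivity) (m - 1)) (by simp; positivity)
      (fun Y hY => ⟨wsum_moebius_log_pow_nonneg (by lia) hY, h m hm Y hY⟩) hX
    refine ⟨h1, h2.trans (le_of_eq ?_)⟩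
    rw [prod_primeFactors_inv hq]
    ring
  obtain ⟨h1, h2⟩ := wsum_log_pow_exp_bounds hk (sub_nonneg.2 hσ) hb
  rw [sum_coprime_moebius_eq hq k hX]
  refine ⟨mul_nonneg (Real.exp_pos _).le h1, ?_⟩
  refine (mul_le_mul_of_nonneg_left h2 (Real.exp_pos _).le).trans (le_of_eq ?_)
  rw [Real.exp_neg]
  field_simp

end

theorem theorem1p1 (q k : ℕ) (hq : 1 ≤ q) (hk : 1 ≤ k) (σ X : ℝ) (hσ : 1 ≤ σ) (hX : 1 ≤ X) :
    (0 ≤ ∑ n ∈ (Finset.Icc 1 ⌊X⌋₊).filter (fun n => Nat.Coprime n q),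
        (ArithmeticFunction.moebius n : ℝ) / (n : ℝ) ^ σ * Real.log (X / (n : ℝ)) ^ k) ∧
    (∑ n ∈ (Finset.Icc 1 ⌊X⌋₊).filter (fun n => Nat.Coprime n q),
        (ArithmeticFunction.moebius n : ℝ) / (n : ℝ) ^ σ * Real.log (X / (n : ℝ)) ^ k
      ≤ 1.00303 * ((q : ℝ) / (Nat.totient q : ℝ)) *
          ((k : ℝ) + (σ - 1) * Real.log X) * Real.log X ^ (k - 1)) ∧
    (k ≠ 1 →
      ∑ n ∈ (Finset.Icc 1 ⌊X⌋₊).filter (fun n => Nat.Coprime n q),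
        (ArithmeticFunction.moebius n : ℝ) / (n : ℝ) ^ σ * Real.log (X / (n : ℝ)) ^ k
      ≤ ((q : ℝ) / (Nat.totient q : ℝ)) *
          ((k : ℝ) + (σ - 1) * Real.log X) * Real.log X ^ (k - 1)) := by
  have hq0 : q ≠ 0 := by lia
  obtain ⟨h1, h2⟩ := sum_coprime_moebius_bounds (c := 1.00303) hq0 hk hσ hX (by norm_num)
    -- The exponential series uses every power m ≥ k. Only m = 1 needs the constant 1.00303, so for
    -- k ≥ 2 it can be dropped.
    fun m hm Y hY => by
      rcases (by lia : m = 1 ∨ 2 ≤ m) with rfl | hm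
      · simpa using wsum_moebius_log_le hY
      · refine (wsum_moebius_log_pow_le hm hY).trans ?_
        have := Real.log_nonneg hY
        rw [mul_assoc]
        exact le_mul_of_one_le_left (by positivity) (by norm_num)
  refine ⟨h1, h2, fun hk1 => ?_⟩
  have := (sum_coprime_moebius_bounds (c := 1) hq0 hk hσ hX zero_le_one fun m hm Y hY => by
    rw [one_mul]; exact wsum_moebius_log_pow_le (by lia) hY).2
  rwa [one_mul] at this
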